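/- Conventions. A field $K$ is a function field over a field $k$ if it is a finitely generated field extension of $k$. A global field is a number field or a function field of transcendence degree $1$ over a finite field. For a valuation $v$ on $K$, let $\Gamma_v$ be its value group, $A_v$ its valuation ring, $M_v$ its maximal ideal, $U_v=A_v^*$ its unit group and $K_v$ its residue field; $v|k$ is the restriction of $v$ to $k$. For an abelian group $\Gamma$, $\operatorname{rk}_{\mathbb Q}(\Gamma)=\dim_{\mathbb Q}(\Gamma\otimes_{\mathbb Z}\mathbb Q)$. If $K$ is a function field over $k$, a valuation $v$ on $K$ is Abhyankar (relative to $k$) if $\operatorname{trdeg}(K:k)=\operatorname{rk}_{\mathbb Q}(\Gamma_v/\Gamma_{v|k})+\operatorname{trdeg}(K_v:k_{v|k})$. The nominal transcendence degree $\operatorname{ntd}(F)$ of a field $F$ is $\operatorname{trdeg}(F:\mathbb Q)$ if $\operatorname{char}F=0$ and $\operatorname{trdeg}(F:\mathbb F_p)-1$ if $\operatorname{char}F=p\neq0$. For a subgroup $T$ of $K^*$, an element $x\in K^*$ is $T$-rigid if $T+Tx\subseteq T\cup Tx$ (the sum being formed in $K$, so that it may contain $0$), and the basic part of $T$ is $B(T)=\{x\in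 K^*: x \text{ or } -x \text{ is not } T\text{-rigid}\}$. Theorem. Let $K$ be a function field over a global field $k$, let $v$ be a valuation on $K$ that is Abhyankar relative to $k$ (the trivial valuation is allowed), and let $T=(1+M_v)K^{*2}$. Then $T\subseteq U_vK^{*2}$, and $\operatorname{ntd}(K_v)\ge 0$ if and only if $K_v$ is infinite. Moreover: (1) $\operatorname{rk}_{\mathbb Q}(\Gamma_v)$ is finite and $(K^*:U_vK^{*2})=2^{\operatorname{rk}_{\mathbb Q}(\Gamma_v)}$. (2) The index $(U_vK^{*2}:T)$ is $\infty$ if $\operatorname{ntd}(K_v)\ge 0$; it is $2$ if $K_v$ is finite with $\operatorname{char}(K_v)\ne 2$; it is $1$ if $K_v$ is finite with $\operatorname{char}(K_v)=2$. (3) The basic part of $T$ is as follows: $B(T)=U_vK^{*2}$ if $\operatorname{ntd}(K_v)\ge 0$; $B(T)=T\cup -T=U_vK^{*2}$ if $K_v$ is finite, $\operatorname{char}(K_v)\ne 2$ and $-1\notin K_v^{*2}$; $B(T)=T$ if $K_v$ is finite, $\operatorname{char}(K_v)\neq 2$ and $-1\in K_v^{*2}$; $B(T)=T=U_vK^{*2}$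 if $K_v$ is finite with $\operatorname{char}(K_v)=2$. -/

import Mathlib

noncomputable section

open scoped TensorProduct

/-- `K` is a function field over `k`: a finitely generated field extension of `k`. -/
def IsFunctionFieldOver (k K : Type*) [Field k] [Field K] [Algebra k K] : Prop :=
  (⊤ : IntermediateField k K).FG

/-- A global field: a number field, or a function field of transcendence degree `1` over a
finite field. -/
def IsGlobalField (k : Type*) [Field k] : Prop :=
  NumberField k ∨
    ∃ F : Subfield k, Finite F ∧ IsFunctionFieldOver F k ∧ Algebra.trdeg F k = 1

/-- The rational rank of an abelian group `G` (written multiplicatively): the dimension of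
`ℚ ⊗ G` over `ℚ`, with value `⊤` if the dimension is infinite. -/
def rationalRank (G : Type*) [CommGroup G] : ℕ∞ :=
  Cardinal.toENat (Module.rank ℚ (ℚ ⊗[ℤ] Additive G))

/-- The transcendence degree of `K` over `k`, with value `⊤` if it is infinite. -/
def etrdeg (k K : Type*) [Field k] [Field K] [Algebra k K] : ℕ∞ :=
  Cardinal.toENat (Algebra.trdeg k K)

/-- The nominal transcendence degree: the transcendence degree over the prime field, lowered by
one if the characteristic is positive. -/
def ntd (K : Type*) [Field K] : WithTop ℤ :=
  (etrdeg (⊥ : Subfield K) K).map fun n : ℕ => if ringChar K = 0 then (n : ℤ) else (n : ℤ) - 1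

namespace Valuation

section Extension

variable {k K Γ₀ : Type*} [Field k] [Field K] [Algebra k K]
  [LinearOrderedCommGroupWithZero Γ₀] (v : Valuation K Γ₀)

/-- A valuation extends its own restriction; this makes the residue field of `v` an algebra over
the residue field of the restriction. -/
instance hasExtension_comap : (v.comap (algebraMap k K)).HasExtension v :=
  ⟨Valuation.IsEquiv.refl⟩

variable (k) in
/-- The value group of the restriction of `v` to `k`, as a subgroup of the value group of `v`. -/
def restrictedValueGroup : Subgroup (MonoidWithZeroHom.valueGroup (.ofClass v)) :=
  (MonoidWithZeroHom.valueGroup (.ofClass (v.comap (algebraMap k K)))).subgroupOf _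

variable (k) in
/-- `v` is Abhyankar relative to `k`: equality holds in the Abhyankar inequality
`trdeg (K : k) ≥ rk_ℚ (Γ_v / Γ_{v|k}) + trdeg (K_v : k_{v|k})`. -/
def IsAbhyankar : Prop :=
  etrdeg k K =
    rationalRank (MonoidWithZeroHom.valueGroup (.ofClass v) ⧸ v.restrictedValueGroup k) +
      etrdeg (IsLocalRing.ResidueField (v.comap (algebraMap k K)).valuationSubring)
        (IsLocalRing.ResidueField v.valuationSubring)

end Extension

section Groups

variable {K Γ₀ : Type*} [Field K] [LinearOrderedCommGroupWithZero Γ₀] (v : Valuation K Γ₀)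

/-- The subgroup `U_v K*²` of `K*`. -/
def unitsMulSquares : Subgroup Kˣ := v.valuationSubring.unitGroup ⊔ Subgroup.square Kˣ

/-- The subgroup `(1 + M_v) K*²` of `K*`. -/
def principalUnitsMulSquares : Subgroup Kˣ :=
  v.valuationSubring.principalUnitGroup ⊔ Subgroup.square Kˣ

end Groups

end Valuation

section Rigid

variable {K : Type*} [Field K]

/-- `x ∈ K*` is `T`-rigid: `T + T x ⊆ T ∪ T x`, the sum being formed in `K`. -/
def IsRigidElement (T : Subgroup Kˣ) (x : Kˣ) : Prop :=
  ∀ s ∈ T, ∀ t ∈ T, ∃ u ∈ T, (s : K) + t * x = u ∨ (s : K) + t * x = u * x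

/-- The basic part `B(T)`: the `x ∈ K*` such that `x` or `-x` is not `T`-rigid. -/
def basicPart (T : Subgroup Kˣ) : Set Kˣ :=
  {x | ¬ IsRigidElement T x ∨ ¬ IsRigidElement T (-x)}

/-- The set `±T = T ∪ -T`. -/
def plusMinus (T : Subgroup Kˣ) : Set Kˣ := {x | x ∈ T ∨ -x ∈ T}

end Rigid

end

/-!
# Rigid elements and Abhyankar valuations on function fields over global fields

The proof rests on one finiteness property: the value group and the residue field of `v` are
finitely generated (`Valuation.HasFGInvariants`). Adjoining elements whose values are independent
modulo the old value group enlarges that group by a free group and leaves the residue field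
alone, adjoining elements with algebraically independent residues enlarges the residue field by a
purely transcendental extension and leaves the value group alone, and a finite extension changes
both only by finitely many generators. Over a prime field everything is explicit, and a global
field arises from its prime field by such steps (`Valuation.hasFGInvariants_of_isGlobalField`). For
an Abhyankar valuation of `K`, elements of `K` with independent values and residues that attain the
Abhyankar bound form a transcendence basis, so `K` arises from `k` by such steps as well
(`Valuation.IsAbhyankar.hasFGInvariants`). A finitely generated torsion-free value group of rank `r`
has `2 ^ r` classes modulo squares, which is the index of `U_v K*²`.

The rest takes place in the residue field `F = K_v`, since `U_v K*² / (1 + M_v) K*²` is the group of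
square classes of `F`. For finite `F` this has order one or two. If `F` is infinite, then, being
finitely generated, it has for every `a ≠ 0` a discrete valuation, trivial on any given finite set
of nonzero elements, at which `a` becomes a square in the residue field (`hasSplitPlaces_of_fg`): in a
number field, `1 - a z²` is not a unit for large integers `z`, and otherwise `a` can be made transcendental by a
square factor, and one takes a place above a prime factor of `1 - t d²` in a polynomial ring in `t`.
Two consequences follow. There are infinitely many square classes, because a uniformizer is in no
class represented by a unit; and no element `a` is rigid with respect to `F*²`, because if `-a` is a
square at the place, then some `x² + a` has odd value (`HasSplitPlaces.not_isRigidElement_square`;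
in characteristic two, `1 + a` and `a + a` already show it).

Finally, rigidity is compared with the residue field. In a sum `s + t x` whose terms have different
values, the dominating term absorbs the other, so only terms of equal value matter; for `x` outside
`U_v K*²` there are none, and such `x` are rigid. A unit that is rigid in `K` has a rigid residue,
so for infinite `F` no element of `U_v K*²` is rigid. If `F` is finite of odd characteristic and
`-1` is a square in `F`, then the elements of `U_v K*²` outside `T = (1 + M_v) K*²` are rigid by
index two (`Valuation.isRigidElement_of_relIndex_eq_two`). In all cases, `x` is not rigid if `-x` is
in `T`, because `T + T x` then contains `0`.
-/

/-! ### Value group and residue field of a subfield -/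

namespace Valuation

open IsLocalRing Polynomial

variable {K Γ₀ : Type*} [Field K] [LinearOrderedCommGroupWithZero Γ₀] (v : Valuation K Γ₀)

/-- The group of values of `v` on the nonzero elements of a subfield `L`. -/
def valueSubgroup (L : Subfield K) : Subgroup Γ₀ˣ where
  carrier := {γ | ∃ l ∈ L, v l = γ}
  one_mem' := ⟨1, one_mem L, by simp⟩
  mul_mem' := by
    rintro a b ⟨l, hl, hla⟩ ⟨m, hm, hmb⟩
    exact ⟨l * m, mul_mem hl hm, by simp [hla, hmb]⟩
  inv_mem' := by
    rintro a ⟨l, hl, hla⟩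
    exact ⟨l⁻¹, inv_mem hl, by simp [hla]⟩

/-- The residue field of the restriction of `v` to a subfield `L`, as a subfield of the residue
field of `v`. -/
def residueSubfield (L : Subfield K) : Subfield (ResidueField v.valuationSubring) where
  carrier := {ξ | ∃ l : v.valuationSubring, (l : K) ∈ L ∧ residue _ l = ξ}
  one_mem' := ⟨1, one_mem L, map_one _⟩
  zero_mem' := ⟨0, zero_mem L, map_zero _⟩
  mul_mem' := by
    rintro a b ⟨l, hl, rfl⟩ ⟨m, hm, rfl⟩
    exact ⟨l * m, mul_mem hl hm, map_mul _ _ _⟩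
  add_mem' := by
    rintro a b ⟨l, hl, rfl⟩ ⟨m, hm, rfl⟩
    exact ⟨l + m, add_mem hl hm, map_add _ _ _⟩
  neg_mem' := by
    rintro a ⟨l, hl, rfl⟩
    exact ⟨-l, neg_mem hl, _root_.map_neg _ _⟩
  inv_mem' := by
    rintro a ⟨l, hl, rfl⟩
    by_cases h0 : residue _ l = 0
    · exact ⟨0, zero_mem L, by simp [h0]⟩
    obtain ⟨u, rfl⟩ := (residue_ne_zero_iff_isUnit l).1 h0
    refine ⟨(u⁻¹ : v.valuationSubringˣ), ?_, ?_⟩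
    · have : (((u⁻¹ : v.valuationSubringˣ) : v.valuationSubring) : K) =
          ((u : v.valuationSubring) : K)⁻¹ := by
        rw [eq_comm, inv_eq_iff_eq_inv, eq_comm]
        refine inv_eq_of_mul_eq_one_left ?_
        exact_mod_cast congrArg (fun x : v.valuationSubring => (x : K)) u.mul_inv
      rw [this]
      exact inv_mem hl
    · exact (map_units_inv (residue v.valuationSubring) u)

variable {v}

lemma mem_valueSubgroup {L : Subfield K} {γ : Γ₀ˣ} :
    γ ∈ v.valueSubgroup L ↔ ∃ l ∈ L, v l = γ := Iff.rfl

lemma mk0_mem_valueSubgroup {L : Subfield K} {l : K} (hl : l ∈ L) (h0 : v l ≠ 0) :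
    Units.mk0 (v l) h0 ∈ v.valueSubgroup L := ⟨l, hl, rfl⟩

lemma residue_eq_zero_iff_lt_one (x : v.valuationSubring) :
    residue _ x = 0 ↔ v (x : K) < 1 := by
  rw [residue_eq_zero_iff]
  exact v.mem_maximalIdeal_iff

lemma residue_ne_zero_iff_eq_one (x : v.valuationSubring) :
    residue _ x ≠ 0 ↔ v (x : K) = 1 := by
  rw [Ne, residue_eq_zero_iff_lt_one, not_lt]
  exact ⟨fun h => le_antisymm x.2 h, fun h => h.ge⟩

lemma residue_eq_iff_sub_lt_one (x y : v.valuationSubring) :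
    residue _ x = residue _ y ↔ v ((x : K) - y) < 1 := by
  rw [← sub_eq_zero, ← _root_.map_sub, residue_eq_zero_iff_lt_one]
  rfl

lemma valueSubgroup_mono {L M : Subfield K} (h : L ≤ M) : v.valueSubgroup L ≤ v.valueSubgroup M :=
  fun _ ⟨l, hl, e⟩ => ⟨l, h hl, e⟩

lemma residueSubfield_mono {L M : Subfield K} (h : L ≤ M) :
    v.residueSubfield L ≤ v.residueSubfield M :=
  fun _ ⟨l, hl, e⟩ => ⟨l, h hl, e⟩

/-! ### Simple transcendental extensions -/

/-- Every element of `L(x)` is a quotient of two polynomials in `x` over `L`. -/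
lemma exists_aeval_div_of_mem_closure_insert {L : Subfield K} {x z : K}
    (hz : z ∈ Subfield.closure (insert x (L : Set K))) :
    ∃ p q : L[X], z = aeval x p / aeval x q := by
  have : Subfield.closure (insert x (L : Set K)) = (IntermediateField.adjoin L {x}).toSubfield := by
    rw [IntermediateField.adjoin_toSubfield]
    congr 1
    ext y
    constructor
    · rintro (rfl | hy)
      · exact Or.inr rfl
      · exact Or.inl ⟨⟨y, hy⟩, rfl⟩
    · rintro (⟨⟨y, hy⟩, rfl⟩ | rfl)
      · exact Or.inr hy
      · exact Or.inl rfl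
  rw [this] at hz
  exact (IntermediateField.mem_adjoin_simple_iff L z).1 hz

section ValueTranscendental

variable {L : Subfield K} {x : K}

/-- The value of `x` has infinite order modulo the value group of `L`. As `l = 0` is allowed, this
excludes `x = 0`. -/
def ValueTranscendental (v : Valuation K Γ₀) (L : Subfield K) (x : K) : Prop :=
  ∀ n : ℤ, n ≠ 0 → ∀ l ∈ L, v x ^ n ≠ v l

lemma ValueTranscendental.ne_zero (hx : ValueTranscendental v L x) : x ≠ 0 := by
  rintro rfl
  exact hx 1 one_ne_zero 0 (zero_mem L) (by simp)

/-- The terms of a polynomial in `x` have pairwise distinct values, so that one of them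
dominates the sum of the others. -/
lemma ValueTranscendental.exists_dominant_term (hx : ValueTranscendental v L x) {p : L[X]}
    (hp : p ≠ 0) : ∃ c ∈ L, c ≠ 0 ∧ ∃ n : ℕ, v (aeval x p - c * x ^ n) < v (c * x ^ n) := by
  classical
  have hx0 : v x ≠ 0 := (v.ne_zero_iff).2 hx.ne_zero
  obtain ⟨n, hn, hmax⟩ := p.support.exists_max_image (fun i => v ((p.coeff i : K) * x ^ i))
    (support_nonempty.2 hp)
  have hc : ∀ i ∈ p.support, v (p.coeff i : K) ≠ 0 := fun i hi => by
    rw [v.ne_zero_iff]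
    exact_mod_cast mem_support_iff.1 hi
  refine ⟨p.coeff n, (p.coeff n).2, by exact_mod_cast mem_support_iff.1 hn, n, ?_⟩
  have hsum : aeval x p - (p.coeff n : K) * x ^ n =
      ∑ i ∈ p.support.erase n, (p.coeff i : K) * x ^ i := by
    rw [sub_eq_iff_eq_add, Finset.sum_erase_add _ _ hn, aeval_def, eval₂_eq_sum, Polynomial.sum_def]
    rfl
  rw [hsum]
  refine v.map_sum_lt ?_ fun i hi => ?_
  · rw [map_mul, map_pow]
    exact mul_ne_zero (hc n hn) (pow_ne_zero _ hx0)
  obtain ⟨hin, hi⟩ := Finset.mem_erase.1 hi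
  refine lt_of_le_of_ne (hmax i hi) fun h => ?_
  refine hx ((i : ℤ) - n) (sub_ne_zero.2 (by exact_mod_cast hin))
    (p.coeff n / p.coeff i) (div_mem (p.coeff n).2 (p.coeff i).2) ?_
  simp only [map_mul, map_pow] at h
  rw [zpow_sub₀ hx0, zpow_natCast, zpow_natCast, map_div₀, div_eq_div_iff (pow_ne_zero _ hx0)
    (hc i hi), mul_comm, h]

lemma ValueTranscendental.transcendental (hx : ValueTranscendental v L x) :
    Transcendental L x := by
  rw [transcendental_iff]
  intro p hp
  by_contra h
  obtain ⟨c, -, -, n, hlt⟩ := hx.exists_dominant_term h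
  rw [hp, zero_sub, Valuation.map_neg] at hlt
  exact lt_irrefl _ hlt

lemma map_div_sub_one_lt {a b : K} (ha : v (a - 1) < 1) (hb : v (b - 1) < 1) :
    v (a / b - 1) < 1 := by
  have hb1 : v b = 1 := by simpa using v.map_one_add_of_lt hb
  have hb0 : b ≠ 0 := (v.ne_zero_iff).1 (by simp [hb1])
  have : a / b - 1 = ((a - 1) - (b - 1)) / b := by field_simp; ring
  rw [this, map_div₀, hb1, div_one]
  exact v.map_sub_lt ha hb

/-- A nonzero element of `L(x)` is a monomial `c xⁿ` up to a principal unit. -/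
lemma ValueTranscendental.exists_monomial (hx : ValueTranscendental v L x) {z : K}
    (hz : z ∈ Subfield.closure (insert x (L : Set K))) (hz0 : z ≠ 0) :
    ∃ c ∈ L, c ≠ 0 ∧ ∃ n : ℤ, v (z / (c * x ^ n) - 1) < 1 := by
  obtain ⟨p, q, rfl⟩ := exists_aeval_div_of_mem_closure_insert hz
  have key : ∀ p : L[X], aeval x p ≠ 0 →
      ∃ c ∈ L, c ≠ 0 ∧ ∃ n : ℕ, v (aeval x p / (c * x ^ n) - 1) < 1 := by
    intro p hp
    obtain ⟨c, hc, hc0, n, h⟩ := hx.exists_dominant_term (p := p) (by rintro rfl; simp at hp)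
    refine ⟨c, hc, hc0, n, ?_⟩
    have h0 : c * x ^ n ≠ 0 := mul_ne_zero hc0 (pow_ne_zero _ hx.ne_zero)
    rw [div_sub_one h0, map_div₀]
    exact (div_lt_one₀ (zero_lt_iff.2 ((v.ne_zero_iff).2 h0))).2 h
  obtain ⟨c, hc, hc0, n, h⟩ := key p (by rintro h; simp [h] at hz0)
  obtain ⟨d, hd, hd0, m, h'⟩ := key q (by rintro h; simp [h] at hz0)
  refine ⟨c / d, div_mem hc hd, div_ne_zero hc0 hd0, n - m, ?_⟩
  convert! map_div_sub_one_lt h h' using 2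
  have := hx.ne_zero
  rw [zpow_sub₀ this, zpow_natCast, zpow_natCast]
  field_simp

lemma eq_of_map_div_sub_one_lt {a b : K} (h : v (a / b - 1) < 1) : v a = v b := by
  have h1 : v (a / b) = 1 := by simpa using v.map_one_add_of_lt h
  rw [map_div₀] at h1
  exact eq_of_div_eq_one h1

/-- Adjoining an element whose value has infinite order modulo the value group of `L` does not
enlarge the residue field. -/
lemma ValueTranscendental.residueSubfield_le (hx : ValueTranscendental v L x) :
    v.residueSubfield (Subfield.closure (insert x (L : Set K))) ≤ v.residueSubfield L := by
  rintro _ ⟨z, hz, rfl⟩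
  by_cases h0 : residue _ z = 0
  · rw [h0]; exact zero_mem _
  have hz1 : v (z : K) = 1 := (residue_ne_zero_iff_eq_one z).1 h0
  obtain ⟨c, hc, hc0, n, h⟩ := hx.exists_monomial hz (v.ne_zero_iff.1 (by simp [hz1]))
  have hv := eq_of_map_div_sub_one_lt h
  have hn : n = 0 := by
    by_contra hn
    refine hx n hn c⁻¹ (inv_mem hc) ?_
    rw [hz1, map_mul, map_zpow₀] at hv
    rw [map_inv₀, eq_inv_of_mul_eq_one_right hv.symm]
  subst hn
  simp only [zpow_zero, mul_one] at h hv
  refine ⟨⟨c, by rw [mem_valuationSubring_iff, ← hv, hz1]⟩, hc, ?_⟩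
  rw [eq_comm, residue_eq_iff_sub_lt_one]
  rw [div_sub_one hc0, map_div₀, ← hv, hz1, div_one] at h
  exact h

lemma ValueTranscendental.valueSubgroup_le (hx : ValueTranscendental v L x) :
    v.valueSubgroup (Subfield.closure (insert x (L : Set K))) ≤ v.valueSubgroup L ⊔
      Subgroup.zpowers (Units.mk0 (v x) (v.ne_zero_iff.2 hx.ne_zero)) := by
  rintro γ ⟨z, hz, hγ⟩
  obtain ⟨c, hc, hc0, n, h⟩ := hx.exists_monomial hz (v.ne_zero_iff.1 (by simp [hγ]))
  have hv := eq_of_map_div_sub_one_lt h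
  refine Subgroup.mem_sup.2 ⟨Units.mk0 (v c) (v.ne_zero_iff.2 hc0), mk0_mem_valueSubgroup hc _,
    _, Subgroup.zpow_mem_zpowers _ n, ?_⟩
  ext
  simp [← hγ, hv]

end ValueTranscendental

section ResidueTranscendental

variable {L : Subfield K} {y : v.valuationSubring}

/-- A polynomial with integral coefficients over `L`, evaluated at an integral element. -/
lemma exists_residue_aeval (L : Subfield K) (y : v.valuationSubring) {p : L[X]}
    (hp : ∀ i, v (p.coeff i : K) ≤ 1) :
    ∃ q : (v.residueSubfield L)[X], ∃ z : v.valuationSubring, (z : K) = aeval (y : K) p ∧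
      residue _ z = aeval (residue _ y) q ∧
      ∀ i, ((q.coeff i : v.residueSubfield L) : ResidueField v.valuationSubring) =
        residue _ ⟨p.coeff i, hp i⟩ := by
  classical
  let c : ℕ → v.valuationSubring := fun i => ⟨p.coeff i, hp i⟩
  have hc : ∀ i, residue _ (c i) ∈ v.residueSubfield L := fun i => ⟨c i, (p.coeff i).2, rfl⟩
  let q : (v.residueSubfield L)[X] := ∑ i ∈ Finset.range (p.natDegree + 1),
    monomial i ⟨residue _ (c i), hc i⟩
  refine ⟨q, ∑ i ∈ Finset.range (p.natDegree + 1), c i * y ^ i, ?_, ?_, fun i => ?_⟩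
  · rw [aeval_eq_sum_range]
    push_cast
    rfl
  · simp only [q, map_sum, map_mul, map_pow, aeval_monomial]
    rfl
  · simp only [q, finsetSum_coeff, coeff_monomial, Finset.sum_ite_eq', Finset.mem_range]
    split_ifs with h
    · rfl
    · have : p.coeff i = 0 := coeff_eq_zero_of_natDegree_lt (by omega)
      rw [ZeroMemClass.coe_zero, eq_comm, residue_eq_zero_iff_lt_one]
      simp [this]

variable (hy : Transcendental (v.residueSubfield L) (residue _ y))
include hy

/-- Up to a scalar, a nonzero polynomial in `y` is a unit whose residue is a polynomial in the
residue of `y`. -/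
lemma exists_scalar_residue_of_aeval {p : L[X]} (hp : p ≠ 0) :
    ∃ c ∈ L, c ≠ 0 ∧ ∃ z : v.valuationSubring, aeval (y : K) p = c * z ∧ residue _ z ≠ 0 ∧
      residue _ z ∈ Subfield.closure
        (insert (residue _ y) (v.residueSubfield L : Set (ResidueField v.valuationSubring))) := by
  classical
  obtain ⟨n, hn, hmax⟩ := p.support.exists_max_image (fun i => v (p.coeff i : K))
    (support_nonempty.2 hp)
  have hn0 : p.coeff n ≠ 0 := mem_support_iff.1 hn
  have hnK : (p.coeff n : K) ≠ 0 := by exact_mod_cast hn0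
  have hle : ∀ i, v (((C (p.coeff n)⁻¹ * p).coeff i : L) : K) ≤ 1 := by
    intro i
    rw [coeff_C_mul]
    push_cast
    rw [map_mul, map_inv₀, ← div_eq_inv_mul,
      div_le_one₀ (zero_lt_iff.2 (v.ne_zero_iff.2 hnK))]
    by_cases hi : i ∈ p.support
    · exact hmax i hi
    · simp [notMem_support_iff.1 hi]
  obtain ⟨q, z, hz, hzq, hq⟩ := exists_residue_aeval L y hle
  refine ⟨p.coeff n, (p.coeff n).2, hnK, z, ?_, ?_, ?_⟩
  · rw [hz, map_mul, aeval_C]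
    change _ = (p.coeff n : K) * (((p.coeff n)⁻¹ : L) * _)
    push_cast
    field_simp
  · rw [hzq]
    refine fun h => ?_
    have h0 := (transcendental_iff.1 hy) q h
    have := hq n
    rw [h0, coeff_zero, ZeroMemClass.coe_zero, eq_comm, residue_eq_zero_iff_lt_one] at this
    simp [coeff_C_mul, hn0] at this
  · rw [hzq, aeval_eq_sum_range]
    refine sum_mem fun i _ => ?_
    rw [Algebra.smul_def]
    exact mul_mem (Subfield.subset_closure (Set.mem_insert_of_mem _ (q.coeff i).2))
      (pow_mem (Subfield.subset_closure (Set.mem_insert _ _)) _)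

lemma transcendental_of_residue : Transcendental L (y : K) := by
  rw [transcendental_iff]
  intro p hp
  by_contra h
  obtain ⟨c, -, hc0, z, hz, hz0, -⟩ := exists_scalar_residue_of_aeval hy h
  rw [hp, eq_comm, mul_eq_zero, or_iff_right hc0] at hz
  exact hz0 ((residue_eq_zero_iff_lt_one z).2 (by simp [hz]))

/-- A nonzero element of `L(y)` is, up to a scalar, a unit with residue in `E(ȳ)`, where `E` is
the residue field of `L`. -/
lemma exists_scalar_residue {z : K} (hz : z ∈ Subfield.closure (insert (y : K) (L : Set K)))
    (hz0 : z ≠ 0) :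
    ∃ c ∈ L, c ≠ 0 ∧ ∃ w : v.valuationSubring, z = c * w ∧ residue _ w ≠ 0 ∧
      residue _ w ∈ Subfield.closure
        (insert (residue _ y) (v.residueSubfield L : Set (ResidueField v.valuationSubring))) := by
  obtain ⟨p, q, rfl⟩ := exists_aeval_div_of_mem_closure_insert hz
  obtain ⟨c, hc, hc0, w, hw, hw0, hwm⟩ := exists_scalar_residue_of_aeval hy (p := p)
    (by rintro rfl; simp at hz0)
  obtain ⟨d, hd, hd0, u, hu, hu0, hum⟩ := exists_scalar_residue_of_aeval hy (p := q)
    (by rintro rfl; simp at hz0)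
  obtain ⟨u, rfl⟩ := (residue_ne_zero_iff_isUnit u).1 hu0
  have huinv : (((u⁻¹ : v.valuationSubringˣ) : v.valuationSubring) : K) *
      ((u : v.valuationSubring) : K) = 1 := by
    exact_mod_cast congrArg (fun x : v.valuationSubring => (x : K)) u.inv_mul
  refine ⟨c / d, div_mem hc hd, div_ne_zero hc0 hd0, w * (u⁻¹ : v.valuationSubringˣ), ?_, ?_, ?_⟩
  · rw [hw, hu]
    push_cast
    rw [eq_inv_of_mul_eq_one_left huinv]
    have := right_ne_zero_of_mul_eq_one huinv
    field_simp
  · rw [map_mul]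
    exact mul_ne_zero hw0 ((residue_ne_zero_iff_isUnit _).2 (Units.isUnit _))
  · rw [map_mul, map_units_inv]
    exact mul_mem hwm (inv_mem hum)

/-- Adjoining an element whose residue is transcendental over the residue field `E` of `L` enlarges
the residue field to `E(ȳ)`. -/
lemma residueSubfield_le_of_transcendental :
    v.residueSubfield (Subfield.closure (insert (y : K) (L : Set K))) ≤ Subfield.closure
        (insert (residue _ y) (v.residueSubfield L : Set (ResidueField v.valuationSubring))) := by
  rintro _ ⟨z, hz, rfl⟩
  by_cases h0 : residue _ z = 0
  · rw [h0]; exact zero_mem _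
  have hz1 : v (z : K) = 1 := (residue_ne_zero_iff_eq_one z).1 h0
  obtain ⟨c, hc, hc0, w, hw, hw0, hwm⟩ :=
    exists_scalar_residue hy hz (v.ne_zero_iff.1 (by simp [hz1]))
  have hc1 : v c = 1 := by
    have := congrArg v hw
    rw [hz1, map_mul, (residue_ne_zero_iff_eq_one w).1 hw0, mul_one] at this
    exact this.symm
  have : z = ⟨c, hc1.le⟩ * w := Subtype.ext hw
  rw [this, map_mul]
  exact mul_mem (Subfield.subset_closure (Set.mem_insert_of_mem _ ⟨⟨c, hc1.le⟩, hc, rfl⟩)) hwm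

lemma valueSubgroup_le_of_transcendental :
    v.valueSubgroup (Subfield.closure (insert (y : K) (L : Set K))) ≤ v.valueSubgroup L := by
  rintro γ ⟨z, hz, hγ⟩
  obtain ⟨c, hc, hc0, w, hw, hw0, -⟩ :=
    exists_scalar_residue hy hz (v.ne_zero_iff.1 (by simp [hγ]))
  refine ⟨c, hc, ?_⟩
  rw [← hγ, hw, map_mul, (residue_ne_zero_iff_eq_one w).1 hw0, mul_one]

end ResidueTranscendental

/-! ### Finite extensions -/

section Finite

variable {L : Subfield K} (M : IntermediateField L K) [FiniteDimensional L M]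

/-- The value group of a finite extension has finite index over that of `L`: elements whose values
lie in different cosets of the latter are linearly independent over `L`. -/
lemma relIndex_valueSubgroup_ne_zero :
    (v.valueSubgroup L).relIndex (v.valueSubgroup M.toSubfield) ≠ 0 := by
  classical
  let H := (v.valueSubgroup L).subgroupOf (v.valueSubgroup M.toSubfield)
  suffices Finite (v.valueSubgroup M.toSubfield ⧸ H) from Subgroup.index_ne_zero_of_finite
  choose m hm hvm using fun q : v.valueSubgroup M.toSubfield ⧸ H => (Quotient.out q).2
  have hli : LinearIndependent L fun q => (⟨m q, hm q⟩ : M) := by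
    rw [linearIndependent_iff']
    intro s g hg
    by_contra! hne
    obtain ⟨q₁, hq₁, hg₁⟩ := hne
    obtain ⟨q₀, hq₀, hmax⟩ := (s.filter fun q => g q ≠ 0).exists_max_image
      (fun q => v ((g q : K) * m q)) ⟨q₁, by simp [hq₁, hg₁]⟩
    rw [Finset.mem_filter] at hq₀
    have hsum : ∑ q ∈ s.filter (fun q => g q ≠ 0), (g q : K) * m q = 0 := by
      rw [Finset.sum_filter_of_ne (fun q _ h => by rintro h0; simp [h0] at h)]
      have := congrArg (fun x : M => (x : K)) hg
      simpa [Algebra.smul_def] using! this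
    have hne0 : ∀ q, g q ≠ 0 → v ((g q : K) * m q) ≠ 0 := by
      intro q hq
      rw [map_mul, hvm]
      exact mul_ne_zero (v.ne_zero_iff.2 (by exact_mod_cast hq)) (Units.ne_zero _)
    have := v.map_sum_eq_of_lt (s := s.filter fun q => g q ≠ 0)
      (f := fun q => (g q : K) * m q) (j := q₀) (by simp [hq₀]) (fun q hq => by
        rw [Finset.mem_sdiff, Finset.mem_filter, Finset.mem_singleton] at hq
        refine lt_of_le_of_ne (hmax q (Finset.mem_filter.2 hq.1)) fun h => hq.2 ?_
        rw [← Quotient.out_eq q, ← Quotient.out_eq q₀]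
        refine QuotientGroup.eq.2 (Subgroup.mem_subgroupOf.2 ⟨g q / g q₀,
          div_mem (g q).2 (g q₀).2, ?_⟩)
        have h1 : v (g q₀ : K) ≠ 0 := v.ne_zero_iff.2 (by exact_mod_cast hq₀.2)
        rw [map_mul, map_mul, hvm, hvm] at h
        rw [map_div₀]
        push_cast
        rw [div_eq_iff h1, mul_assoc, mul_comm _ (v _), ← h]
        field_simp)
    rw [hsum, map_zero] at this
    exact hne0 _ hq₀.2 this.symm
  exact hli.finite_of_isNoetherian

/-- The residue field of a finite extension of `L` is finitely generated over that of `L`: elements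
whose residues are linearly independent over the latter are linearly independent over `L`. -/
lemma exists_residueSubfield_le_closure :
    ∃ S : Set (ResidueField v.valuationSubring), S.Finite ∧ v.residueSubfield M.toSubfield ≤
      Subfield.closure (S ∪ (v.residueSubfield L : Set (ResidueField v.valuationSubring))) := by
  classical
  obtain ⟨b, hb, hspan, hli⟩ := exists_linearIndependent (v.residueSubfield L)
    (v.residueSubfield M.toSubfield : Set (ResidueField v.valuationSubring))
  choose m hm hres using fun q : b => hb q.2
  have hli' : LinearIndependent L fun q => (⟨m q, hm q⟩ : M) := by
    rw [linearIndependent_iff']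
    intro s g hg
    by_contra! hne
    obtain ⟨q₁, hq₁, hg₁⟩ := hne
    obtain ⟨q₀, hq₀, hmax⟩ := s.exists_max_image (fun q => v (g q : K)) ⟨q₁, hq₁⟩
    have hq0 : v (g q₀ : K) ≠ 0 := fun h => by
      have h1 := hmax q₁ hq₁
      rw [h, le_zero_iff, map_eq_zero] at h1
      exact hg₁ (by exact_mod_cast h1)
    have hle : ∀ q ∈ s, v ((g q : K) / g q₀) ≤ 1 := fun q hq => by
      rw [map_div₀]
      exact div_le_one_of_le₀ (hmax q hq) zero_le
    let c : b → v.valuationSubring := fun q =>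
      if h : v ((g q : K) / g q₀) ≤ 1 then ⟨_, h⟩ else 0
    have hc : ∀ q ∈ s, (c q : K) = (g q : K) / g q₀ := fun q hq => by
      simp only [c, dif_pos (hle q hq)]
    have hcL : ∀ q, (c q : K) ∈ L := fun q => by
      by_cases h : v ((g q : K) / g q₀) ≤ 1
      · simp only [c, dif_pos h]; exact div_mem (g q).2 (g q₀).2
      · simp only [c, dif_neg h]; exact zero_mem L
    have hsum : ∑ q ∈ s, c q * m q = 0 := by
      apply Subtype.ext
      push_cast
      rw [Finset.sum_congr rfl fun q hq => by rw [hc q hq, div_mul_eq_mul_div],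
        ← Finset.sum_div]
      have := congrArg (fun x : M => (x : K)) hg
      have h2 : ∑ q ∈ s, (g q : K) * m q = 0 := by
        simpa [Algebra.smul_def] using! this
      rw [h2, zero_div]
    have hsum' := congrArg (residue v.valuationSubring) hsum
    rw [map_sum, map_zero] at hsum'
    have h3 := linearIndependent_iff'.1 hli s
      (fun q => (⟨residue _ (c q), c q, hcL q, rfl⟩ : v.residueSubfield L)) (by
        rw [← hsum']
        refine Finset.sum_congr rfl fun q _ => ?_
        rw [map_mul, hres, Algebra.smul_def]
        rfl) q₀ hq₀
    have h4 : residue _ (c q₀) = 0 := congrArg Subtype.val h3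
    rw [residue_eq_zero_iff_lt_one, hc q₀ hq₀, map_div₀, div_self hq0] at h4
    exact lt_irrefl _ h4
  have : Finite b := hli'.finite_of_isNoetherian
  refine ⟨b, b.toFinite, fun ξ hξ => ?_⟩
  have h5 : ξ ∈ Submodule.span (v.residueSubfield L) b := hspan ▸ Submodule.subset_span hξ
  clear hξ
  induction h5 using Submodule.span_induction with
  | mem x hx => exact Subfield.subset_closure (Or.inl hx)
  | zero => exact zero_mem _
  | add x y _ _ hx hy => exact add_mem hx hy
  | smul a x _ hx => exact mul_mem (Subfield.subset_closure (Or.inr a.2)) hx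

end Finite

end Valuation

/-! ### Adjoining independent families -/

namespace Valuation

open IsLocalRing Polynomial

variable {K Γ₀ : Type*} [Field K] [LinearOrderedCommGroupWithZero Γ₀] {v : Valuation K Γ₀}

/-- The value group and the residue field of `v` on `L` are contained in a finitely generated
group and in a finitely generated field, respectively. -/
def HasFGInvariants (v : Valuation K Γ₀) (L : Subfield K) : Prop :=
  (∃ S : Set Γ₀ˣ, S.Finite ∧ v.valueSubgroup L ≤ Subgroup.closure S) ∧
    ∃ S : Set (ResidueField v.valuationSubring), S.Finite ∧
      v.residueSubfield L ≤ Subfield.closure S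

lemma HasFGInvariants.mono {L M : Subfield K} (h : v.HasFGInvariants M) (hLM : L ≤ M) :
    v.HasFGInvariants L := by
  obtain ⟨⟨S, hS, hS'⟩, T, hT, hT'⟩ := h
  exact ⟨⟨S, hS, (valueSubgroup_mono hLM).trans hS'⟩, T, hT, (residueSubfield_mono hLM).trans hT'⟩

lemma insert_closure_le {L : Subfield K} {S : Set K} (x : K) :
    Subfield.closure ((L : Set K) ∪ insert x S) =
      Subfield.closure (insert x (Subfield.closure ((L : Set K) ∪ S) : Set K)) := by
  refine le_antisymm (Subfield.closure_le.2 ?_) (Subfield.closure_le.2 ?_)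
  · rintro z (hz | rfl | hz)
    · exact Subfield.subset_closure (Or.inr (Subfield.subset_closure (Or.inl hz)))
    · exact Subfield.subset_closure (Or.inl rfl)
    · exact Subfield.subset_closure (Or.inr (Subfield.subset_closure (Or.inr hz)))
  · rintro z (rfl | hz)
    · exact Subfield.subset_closure (Or.inr (Or.inl rfl))
    · exact Subfield.closure_mono (Set.union_subset_union_right _ (Set.subset_insert _ _)) hz

/-- Transcendence descends from `Subfield.closure (L ∪ S)` to the algebra generated by `S`. -/
lemma transcendental_adjoin_of_closure {L : Subfield K} {S : Set K} {x : K}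
    (h : Transcendental (Subfield.closure ((L : Set K) ∪ S)) x) :
    Transcendental (Algebra.adjoin L S) x := by
  have hle : ∀ z ∈ Algebra.adjoin L S, z ∈ Subfield.closure ((L : Set K) ∪ S) := by
    intro z hz
    induction hz using Algebra.adjoin_induction with
    | mem x hx => exact Subfield.subset_closure (Or.inr hx)
    | algebraMap r => exact Subfield.subset_closure (Or.inl r.2)
    | add x y _ _ hx hy => exact add_mem hx hy
    | mul x y _ _ hx hy => exact mul_mem hx hy
  let f : Algebra.adjoin L S →+* Subfield.closure ((L : Set K) ∪ S) :=
    (algebraMap (Algebra.adjoin L S) K).codRestrict _ fun z => hle z z.2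
  refine Transcendental.of_ringHom_of_comp_eq f (RingHom.id K) h (fun a b hab => ?_) rfl
  exact Subtype.ext (congrArg (Subfield.subtype _) hab)

/-- Transcendence passes from the algebra generated by `S` over `E` to any subfield of
`Subfield.closure (E ∪ S)`. -/
lemma transcendental_of_adjoin {E F : Subfield K} {S : Set K} {x : K}
    (hF : F ≤ Subfield.closure ((E : Set K) ∪ S)) (h : Transcendental (Algebra.adjoin E S) x) :
    Transcendental F x := by
  have h' : Transcendental (IntermediateField.adjoin E S) x := fun halg =>
    h (IntermediateField.isAlgebraic_adjoin_iff.1 halg)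
  have hle : ∀ z ∈ F, z ∈ IntermediateField.adjoin E S := by
    intro z hz
    have := hF hz
    refine (Subfield.closure_le (t := (IntermediateField.adjoin E S).toSubfield)).2 ?_ this
    rintro y (hy | hy)
    · exact (IntermediateField.adjoin E S).algebraMap_mem ⟨y, hy⟩
    · exact IntermediateField.subset_adjoin E S hy
  let f : F →+* IntermediateField.adjoin E S :=
    (algebraMap F K).codRestrict (IntermediateField.adjoin E S) fun z => hle z z.2
  exact Transcendental.of_ringHom_of_comp_eq f (RingHom.id K) h' f.injective rfl

/-- Adjoining elements whose values are multiplicatively independent over the value group of `L`. -/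
lemma adjoin_of_value_independent {L : Subfield K} {ι : Type*} (x : ι → Kˣ)
    (s : Finset ι)
    (hx : ∀ e : ι → ℤ, ∏ i ∈ s, (Units.map (v : K →* Γ₀) (x i)) ^ e i ∈ v.valueSubgroup L →
      ∀ i ∈ s, e i = 0) :
    v.residueSubfield (Subfield.closure ((L : Set K) ∪ (fun i => (x i : K)) '' s)) ≤
        v.residueSubfield L ∧
      (∀ γ ∈ v.valueSubgroup (Subfield.closure ((L : Set K) ∪ (fun i => (x i : K)) '' s)),
        ∃ e : ι → ℤ, ∃ l ∈ v.valueSubgroup L,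
          γ = l * ∏ i ∈ s, (Units.map (v : K →* Γ₀) (x i)) ^ e i) ∧
      AlgebraicIndepOn L (fun i => (x i : K)) (s : Set ι) := by
  classical
  induction s using Finset.induction_on with
  | empty =>
    simp only [Finset.coe_empty, Set.image_empty, Set.union_empty, Finset.prod_empty, mul_one,
      Subfield.closure_eq, le_refl, true_and]
    refine ⟨fun γ hγ => ⟨0, γ, hγ, rfl⟩, ?_⟩
    exact (algebraicIndependent_empty_type_iff).2 (algebraMap L K).injective
  | insert i s hi ih =>
    obtain ⟨h1, h2, h3⟩ := ih fun e he j hj => by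
      have := hx (Function.update e i 0) (by
        rw [Finset.prod_insert hi, Function.update_self, zpow_zero, one_mul]
        rwa [Finset.prod_congr rfl fun j hj => by
          rw [Function.update_of_ne (ne_of_mem_of_not_mem hj hi)]]) j (Finset.mem_insert_of_mem hj)
      rwa [Function.update_of_ne (ne_of_mem_of_not_mem hj hi)] at this
    have hvt : ValueTranscendental v
        (Subfield.closure ((L : Set K) ∪ (fun i => (x i : K)) '' s)) (x i : K) := by
      intro n hn m hm hnm
      have hx0 : v (x i : K) ≠ 0 := v.ne_zero_iff.2 (x i).ne_zero
      have hm0 : v m ≠ 0 := hnm ▸ zpow_ne_zero n hx0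
      obtain ⟨e, l, hl, hml⟩ := h2 _ (mk0_mem_valueSubgroup hm hm0)
      have hpow : Units.mk0 (v m) hm0 = Units.map (v : K →* Γ₀) (x i) ^ n := by
        ext
        simp [← hnm]
      have := hx (Function.update (-e) i n) (by
        rw [Finset.prod_insert hi, Function.update_self]
        rw [Finset.prod_congr rfl fun j hj => by
          rw [Function.update_of_ne (ne_of_mem_of_not_mem hj hi)], ← hpow, hml]
        simpa using hl) i (Finset.mem_insert_self _ _)
      rw [Function.update_self] at this
      exact hn this
    rw [Finset.coe_insert, Set.image_insert_eq, insert_closure_le]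
    refine ⟨hvt.residueSubfield_le.trans h1, fun γ hγ => ?_, ?_⟩
    · obtain ⟨m, hm, _, ⟨n, rfl⟩, rfl⟩ := Subgroup.mem_sup.1 (hvt.valueSubgroup_le hγ)
      obtain ⟨e, l, hl, rfl⟩ := h2 m hm
      refine ⟨Function.update e i n, l, hl, ?_⟩
      have hprod : ∏ j ∈ s, (Units.map (v : K →* Γ₀) (x j)) ^ Function.update e i n j =
          ∏ j ∈ s, (Units.map (v : K →* Γ₀) (x j)) ^ e j :=
        Finset.prod_congr rfl fun j hj => by
          rw [Function.update_of_ne (ne_of_mem_of_not_mem hj hi)]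
      rw [Finset.prod_insert hi, Function.update_self, hprod, mul_assoc,
        mul_comm (∏ j ∈ s, _)]
      congr 2
      exact congrArg (· ^ n) (Units.ext rfl)
    · exact h3.insert (transcendental_adjoin_of_closure hvt.transcendental)

/-- Adjoining elements whose residues are algebraically independent over a field containing the
residue field of `L`. -/
lemma adjoin_of_residue_independent {L : Subfield K}
    {E : Subfield (ResidueField v.valuationSubring)} (hE : v.residueSubfield L ≤ E) {ι : Type*}
    (y : ι → v.valuationSubring) (hy : AlgebraicIndependent E fun i => residue _ (y i))
    (s : Finset ι) :
    v.residueSubfield (Subfield.closure ((L : Set K) ∪ (fun i => (y i : K)) '' s)) ≤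
        Subfield.closure ((E : Set _) ∪ (fun i => residue _ (y i)) '' s) ∧
      v.valueSubgroup (Subfield.closure ((L : Set K) ∪ (fun i => (y i : K)) '' s)) ≤
        v.valueSubgroup L ∧
      AlgebraicIndepOn L (fun i => (y i : K)) (s : Set ι) := by
  classical
  induction s using Finset.induction_on with
  | empty =>
    simp only [Finset.coe_empty, Set.image_empty, Set.union_empty, Subfield.closure_eq, le_refl,
      true_and]
    exact ⟨hE, (algebraicIndependent_empty_type_iff).2 (algebraMap L K).injective⟩
  | insert i s hi ih =>
    obtain ⟨h1, h2, h3⟩ := ih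
    have htr : Transcendental
        (v.residueSubfield (Subfield.closure ((L : Set K) ∪ (fun i => (y i : K)) '' s)))
        (residue _ (y i)) := by
      refine transcendental_of_adjoin h1 ?_
      have hon : AlgebraicIndepOn E (fun i => residue _ (y i)) (insert i (s : Set ι)) :=
        hy.comp _ Subtype.val_injective
      exact ((AlgebraicIndepOn.insert_iff (by simpa using hi)).1 hon).2
    rw [Finset.coe_insert, Set.image_insert_eq, Set.image_insert_eq, insert_closure_le,
      insert_closure_le]
    refine ⟨(residueSubfield_le_of_transcendental htr).trans (Subfield.closure_mono ?_),
      (valueSubgroup_le_of_transcendental htr).trans h2,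
      h3.insert (transcendental_adjoin_of_closure (transcendental_of_residue htr))⟩
    exact Set.insert_subset_insert h1

/-- Adjoining finitely many algebraic elements preserves finite generation of the invariants. -/
lemma HasFGInvariants.adjoin_algebraic {L : Subfield K} (h : v.HasFGInvariants L) {T : Set K}
    (hT : T.Finite) (halg : ∀ t ∈ T, IsAlgebraic L t) :
    v.HasFGInvariants (Subfield.closure ((L : Set K) ∪ T)) := by
  have : Finite T := hT
  have : FiniteDimensional L (IntermediateField.adjoin L T) :=
    IntermediateField.finiteDimensional_adjoin fun x hx => (halg x hx).isIntegral
  have heq : Subfield.closure ((L : Set K) ∪ T) = (IntermediateField.adjoin L T).toSubfield := by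
    rw [IntermediateField.adjoin_toSubfield]
    congr 2
    ext z
    exact ⟨fun hz => ⟨⟨z, hz⟩, rfl⟩, by rintro ⟨⟨z, hz⟩, rfl⟩; exact hz⟩
  obtain ⟨⟨S, hS, hS'⟩, R, hR, hR'⟩ := h
  rw [heq]
  constructor
  · set M := (IntermediateField.adjoin L T).toSubfield
    let H := (v.valueSubgroup L).subgroupOf (v.valueSubgroup M)
    have : Finite (v.valueSubgroup M ⧸ H) :=
      have : H.FiniteIndex := ⟨relIndex_valueSubgroup_ne_zero _⟩
      Subgroup.finite_quotient_of_finiteIndex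
    refine ⟨S ∪ Set.range fun q : v.valueSubgroup M ⧸ H => (q.out : Γ₀ˣ),
      hS.union (Set.finite_range _), fun γ hγ => ?_⟩
    have h1 : (QuotientGroup.mk (⟨γ, hγ⟩ : v.valueSubgroup M) : v.valueSubgroup M ⧸ H) =
      QuotientGroup.mk
        (QuotientGroup.mk (⟨γ, hγ⟩ : v.valueSubgroup M) : v.valueSubgroup M ⧸ H).out :=
      (Quotient.out_eq _).symm
    have h2 := Subgroup.mem_subgroupOf.1 (QuotientGroup.eq.1 h1.symm)
    set q := (QuotientGroup.mk (⟨γ, hγ⟩ : v.valueSubgroup M) : v.valueSubgroup M ⧸ H)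
    have h3 : γ = (q.out : Γ₀ˣ) * ((q.out)⁻¹ * ⟨γ, hγ⟩ : v.valueSubgroup M) := by
      push_cast
      rw [mul_inv_cancel_left]
    rw [h3]
    exact mul_mem (Subgroup.subset_closure (Or.inr ⟨q, rfl⟩))
      (Subgroup.closure_mono Set.subset_union_left (hS' h2))
  · obtain ⟨b, hb, hb'⟩ := exists_residueSubfield_le_closure (v := v) (IntermediateField.adjoin L T)
    refine ⟨b ∪ R, hb.union hR, hb'.trans (Subfield.closure_le.2 ?_)⟩
    rintro z (hz | hz)
    · exact Subfield.subset_closure (Or.inl hz)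
    · exact Subfield.closure_mono Set.subset_union_right (hR' hz)

/-- A finitely generated field `S`, embedded into `K`, inherits finite generation of the invariants
from any subfield containing the images of the base field and of a transcendence basis. -/
lemma HasFGInvariants.of_isTranscendenceBasis {R S ι : Type*} [Field R] [Field S] [Algebra R S]
    (hfg : (⊤ : IntermediateField R S).FG) {w : ι → S} (hw : IsTranscendenceBasis R w)
    (f : S →+* K) {M : Subfield K} (hM : v.HasFGInvariants M)
    (hR : ∀ r : R, f (algebraMap R S r) ∈ M) (hwM : ∀ i, f (w i) ∈ M) :
    v.HasFGInvariants f.fieldRange := by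
  obtain ⟨T, hT⟩ := hfg
  have := hw.isAlgebraic
  have hle : ∀ z ∈ Algebra.adjoin R (Set.range w), f z ∈ M := by
    intro z hz
    induction hz using Algebra.adjoin_induction with
    | mem x hx => obtain ⟨i, rfl⟩ := hx; exact hwM i
    | algebraMap r => exact hR r
    | add x y _ _ hx hy => rw [_root_.map_add]; exact add_mem hx hy
    | mul x y _ _ hx hy => rw [map_mul]; exact mul_mem hx hy
  let g : Algebra.adjoin R (Set.range w) →+* M :=
    (f.comp (algebraMap (Algebra.adjoin R (Set.range w)) S)).codRestrict M fun z => hle z z.2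
  refine (hM.adjoin_algebraic (T := f '' T) (T.finite_toSet.image f) ?_).mono ?_
  · rintro _ ⟨t, -, rfl⟩
    refine (Algebra.IsAlgebraic.isAlgebraic
      (R := Algebra.adjoin R (Set.range w)) t).ringHom_of_comp_eq g f (fun a b hab => ?_) rfl
    exact Subtype.ext (f.injective (congrArg Subtype.val hab))
  · rintro _ ⟨z, rfl⟩
    have hz : z ∈ IntermediateField.adjoin R (T : Set S) := hT ▸ IntermediateField.mem_top
    induction hz using IntermediateField.adjoin_induction with
    | mem x hx => exact Subfield.subset_closure (Or.inr ⟨x, hx, rfl⟩)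
    | algebraMap r => exact Subfield.subset_closure (Or.inl (hR r))
    | add x y _ _ hx hy => rw [_root_.map_add]; exact add_mem hx hy
    | inv x _ hx => rw [map_inv₀]; exact inv_mem hx
    | mul x y _ _ hx hy => rw [map_mul]; exact mul_mem hx hy

/-! ### Global fields -/

section PrincipalIdealRing

variable {A : Type*} [CommRing A] [IsDomain A] [IsPrincipalIdealRing A] (f : A →+* K)
  (hf : ∀ a, v (f a) ≤ 1)
include hf

/-- If `v` is nonnegative on the image of a principal ideal domain `A`, then every element of `A`
is a power of `π` times an element of value `1`, where `π` generates the centre of `v` on `A`. The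
case `π = 0` is that of a trivial valuation. -/
lemma exists_factorization : ∃ π : A, v (f π) < 1 ∧
    ∀ a : A, f a ≠ 0 → ∃ (j : ℕ) (b : A), v (f b) = 1 ∧ f a = f π ^ j * f b := by
  let g : A →+* v.valuationSubring := f.codRestrict v.valuationSubring.toSubring hf
  let P : Ideal A := (maximalIdeal v.valuationSubring).comap g
  have hP : ∀ a, a ∈ P ↔ v (f a) < 1 := fun a => v.mem_maximalIdeal_iff
  obtain ⟨π, hπ⟩ := (IsPrincipalIdealRing.principal P).principal
  have hdvd : ∀ a, π ∣ a ↔ v (f a) < 1 := fun a => by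
    rw [← hP, hπ, Ideal.submodule_span_eq, Ideal.mem_span_singleton]
  have hlt := (hdvd π).1 dvd_rfl
  refine ⟨π, hlt, fun a ha => ?_⟩
  have hunit : ¬ IsUnit π := fun h => by
    have := (hdvd 1).1 h.dvd
    simp at this
  obtain ⟨b, hb, hb'⟩ := (FiniteMultiplicity.of_not_isUnit hunit
    (by rintro rfl; simp at ha : a ≠ 0)).exists_eq_pow_mul_and_not_dvd
  refine ⟨multiplicity π a, b, le_antisymm (hf b) (not_lt.1 fun h => hb' ((hdvd b).2 h)), ?_⟩
  rw [← map_pow, ← map_mul, ← hb]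

/-- A nonzero quotient of elements of `A` is a power of `π`, up to a quotient of elements of value
`1`. -/
lemma exists_factorization_div : ∃ π : A, ∀ a b : A, f a / f b ≠ 0 →
    ∃ (i : ℤ) (m n : A), v (f m) = 1 ∧ v (f n) = 1 ∧ (f π = 0 → i = 0) ∧
      f a / f b = f π ^ i * (f m / f n) ∧ (v (f a / f b) = 1 → i = 0) := by
  obtain ⟨π, hπ, hfac⟩ := exists_factorization f hf
  refine ⟨π, fun a b hab => ?_⟩
  obtain ⟨i, m, hm, hm'⟩ := hfac a (by rintro h; simp [h] at hab)
  obtain ⟨j, n, hn, hn'⟩ := hfac b (by rintro h; simp [h] at hab)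
  by_cases h0 : f π = 0
  · have hi : i = 0 := by by_contra h; simp [hm', h0, h] at hab
    have hj : j = 0 := by by_contra h; simp [hn', h0, h] at hab
    exact ⟨0, m, n, hm, hn, fun _ => rfl, by simp [hm', hn', hi, hj], fun _ => rfl⟩
  · have heq : f a / f b = f π ^ ((i : ℤ) - j) * (f m / f n) := by
      rw [hm', hn', zpow_sub₀ h0, zpow_natCast, zpow_natCast, mul_div_mul_comm]
    refine ⟨i - j, m, n, hm, hn, fun h => absurd h h0, heq, fun h1 => ?_⟩
    rw [heq, map_mul, map_div₀, hm, hn, div_one, mul_one, map_zpow₀] at h1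
    by_contra h
    exact h ((zpow_eq_one_iff_right₀ zero_le hπ.ne).1 h1)

lemma exists_valueSubgroup_le_zpowers {L : Subfield K} (hL : ∀ z ∈ L, ∃ a b, z = f a / f b) :
    ∃ g : Γ₀ˣ, v.valueSubgroup L ≤ Subgroup.zpowers g := by
  obtain ⟨π, hπ⟩ := exists_factorization_div f hf
  have key : ∀ γ ∈ v.valueSubgroup L, ∃ i : ℤ, (f π = 0 → i = 0) ∧ (γ : Γ₀) = v (f π) ^ i := by
    rintro γ ⟨z, hz, hγ⟩
    obtain ⟨a, b, rfl⟩ := hL z hz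
    obtain ⟨i, m, n, hm, hn, h0, heq, -⟩ := hπ a b (v.ne_zero_iff.1 (by simp [hγ]))
    refine ⟨i, h0, ?_⟩
    rw [← hγ, heq, map_mul, map_div₀, hm, hn, div_one, mul_one, map_zpow₀]
  by_cases h0 : f π = 0
  · refine ⟨1, fun γ hγ => ?_⟩
    obtain ⟨i, hi, hγi⟩ := key γ hγ
    have : γ = 1 := Units.ext (by simp [hγi, hi h0])
    rw [this]
    exact one_mem _
  · refine ⟨Units.mk0 _ (v.ne_zero_iff.2 h0), fun γ hγ => ?_⟩
    obtain ⟨i, -, hγi⟩ := key γ hγ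
    exact ⟨i, Units.ext (by simp [hγi])⟩

end PrincipalIdealRing

lemma exists_intCast_div_of_mem_bot {z : K} (hz : z ∈ (⊥ : Subfield K)) :
    ∃ a b : ℤ, z = Int.castRingHom K a / Int.castRingHom K b := by
  rw [← Subfield.closure_empty, Subfield.mem_closure_iff] at hz
  obtain ⟨a, ha, b, hb, rfl⟩ := hz
  rw [Subring.closure_empty, Subring.mem_bot] at ha hb
  obtain ⟨a, rfl⟩ := ha
  obtain ⟨b, rfl⟩ := hb
  exact ⟨a, b, rfl⟩

lemma map_intCast_le_one (v : Valuation K Γ₀) (m : ℤ) : v (Int.castRingHom K m) ≤ 1 := by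
  have : (m : K) ∈ v.valuationSubring := intCast_mem _ m
  exact this

/-- On the prime field, every valuation is trivial or `p`-adic. -/
lemma hasFGInvariants_bot (v : Valuation K Γ₀) : v.HasFGInvariants ⊥ := by
  constructor
  · obtain ⟨g, hg⟩ := exists_valueSubgroup_le_zpowers (Int.castRingHom K)
      (map_intCast_le_one v) fun _ => exists_intCast_div_of_mem_bot
    exact ⟨{g}, Set.finite_singleton g, by rwa [← Subgroup.zpowers_eq_closure]⟩
  · obtain ⟨π, hπ⟩ := exists_factorization_div (Int.castRingHom K) (map_intCast_le_one v)
    refine ⟨∅, Set.finite_empty, ?_⟩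
    rintro _ ⟨z, hz, rfl⟩
    by_cases h0 : residue _ z = 0
    · rw [h0]; exact zero_mem _
    have hz1 : v (z : K) = 1 := (residue_ne_zero_iff_eq_one z).1 h0
    obtain ⟨a, b, hab⟩ := exists_intCast_div_of_mem_bot hz
    obtain ⟨i, m, n, hm, hn, -, heq, hi⟩ := hπ a b (v.ne_zero_iff.1 (by rw [← hab, hz1]; simp))
    rw [← hab, hi (hab ▸ hz1), zpow_zero, one_mul] at heq
    simp only [eq_intCast] at heq hm hn
    have hn0 : (n : K) ≠ 0 := v.ne_zero_iff.1 (by simp [hn])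
    have hzn : z * (n : v.valuationSubring) = (m : v.valuationSubring) := by
      apply Subtype.ext
      push_cast
      rw [heq]
      field_simp
    have := congrArg (residue v.valuationSubring) hzn
    rw [map_mul, map_intCast, map_intCast] at this
    have hn1 : ((n : ℤ) : ResidueField v.valuationSubring) ≠ 0 := by
      rw [← map_intCast (residue v.valuationSubring), residue_ne_zero_iff_eq_one]
      exact_mod_cast hn
    rw [eq_div_of_mul_eq hn1 this]
    exact div_mem (intCast_mem _ _) (intCast_mem _ _)

end Valuation

namespace Valuation

open IsLocalRing Polynomial

variable {K Γ₀ : Type*} [Field K] [LinearOrderedCommGroupWithZero Γ₀] {v : Valuation K Γ₀}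

lemma HasFGInvariants.adjoin_value_independent {L : Subfield K} (h : v.HasFGInvariants L)
    {ι : Type*} [Fintype ι] (x : ι → Kˣ)
    (hx : ∀ e : ι → ℤ, ∏ i, (Units.map (v : K →* Γ₀) (x i)) ^ e i ∈ v.valueSubgroup L →
      ∀ i, e i = 0) :
    v.HasFGInvariants (Subfield.closure ((L : Set K) ∪ Set.range fun i => (x i : K))) := by
  obtain ⟨h1, h2, -⟩ := adjoin_of_value_independent (v := v) x Finset.univ fun e he i _ => hx e he i
  rw [Finset.coe_univ, Set.image_univ] at h1 h2
  obtain ⟨⟨S, hS, hS'⟩, T, hT, hT'⟩ := h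
  refine ⟨⟨S ∪ Set.range fun i => Units.map (v : K →* Γ₀) (x i), hS.union (Set.finite_range _),
    fun γ hγ => ?_⟩, T, hT, h1.trans hT'⟩
  obtain ⟨e, l, hl, rfl⟩ := h2 γ hγ
  refine mul_mem (Subgroup.closure_mono Set.subset_union_left (hS' hl))
    (Subgroup.prod_mem _ fun i _ => zpow_mem ?_ _)
  exact Subgroup.subset_closure (Or.inr ⟨i, rfl⟩)

lemma HasFGInvariants.adjoin_residue_independent {L : Subfield K} (h : v.HasFGInvariants L)
    {E : Subfield (ResidueField v.valuationSubring)} (hLE : v.residueSubfield L ≤ E)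
    (hE : ∃ T : Set (ResidueField v.valuationSubring), T.Finite ∧ E ≤ Subfield.closure T)
    {ι : Type*} [Fintype ι] (y : ι → v.valuationSubring)
    (hy : AlgebraicIndependent E fun i => residue _ (y i)) :
    v.HasFGInvariants (Subfield.closure ((L : Set K) ∪ Set.range fun i => (y i : K))) := by
  obtain ⟨h1, h2, -⟩ := adjoin_of_residue_independent hLE y hy Finset.univ
  rw [Finset.coe_univ, Set.image_univ] at h1 h2
  rw [Set.image_univ] at h1
  obtain ⟨⟨S, hS, hS'⟩, -⟩ := h
  obtain ⟨T, hT, hT'⟩ := hE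
  refine ⟨⟨S, hS, h2.trans hS'⟩, T ∪ Set.range fun i => residue _ (y i),
    hT.union (Set.finite_range _), h1.trans (Subfield.closure_le.2 ?_)⟩
  rintro z (hz | hz)
  · exact Subfield.closure_mono Set.subset_union_left (hT' hz)
  · exact Subfield.subset_closure (Or.inr hz)

/-- If `v` is trivial on a finitely generated subfield, then its invariants there are finitely
generated, because the residue map embeds the subfield into the residue field. -/
lemma hasFGInvariants_of_trivial {k : Type*} [Field k] (f : k →+* K) {T : Set k} (hT : T.Finite)
    (hTk : Subfield.closure T = ⊤) (htriv : ∀ a : k, a ≠ 0 → v (f a) = 1) :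
    v.HasFGInvariants f.fieldRange := by
  have hle : ∀ a, f a ∈ v.valuationSubring := fun a => by
    by_cases h : a = 0
    · simp [h]
    · exact (htriv a h).le
  let g : k →+* v.valuationSubring := f.codRestrict v.valuationSubring.toSubring hle
  let φ : k →+* ResidueField v.valuationSubring := (residue _).comp g
  refine ⟨⟨∅, Set.finite_empty, ?_⟩, φ '' T, hT.image φ, ?_⟩
  · rintro γ ⟨_, ⟨a, rfl⟩, ha⟩
    have : γ = 1 := by
      ext
      rw [← ha, htriv a (by rintro rfl; simp [eq_comm] at ha), Units.val_one]
    rw [this]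
    exact one_mem _
  · rintro _ ⟨⟨l, hl⟩, ⟨a, rfl⟩, rfl⟩
    change φ a ∈ _
    have hle' : Subfield.closure T ≤ (Subfield.closure (φ '' T)).comap φ :=
      Subfield.closure_le.2 fun t ht => Subfield.subset_closure ⟨t, ht, rfl⟩
    exact hle' (hTk ▸ Subfield.mem_top a)

lemma eq_one_of_finite {F : Type*} [Field F] [Finite F] (f : F →+* K) {a : F} (ha : a ≠ 0) :
    v (f a) = 1 := by
  obtain ⟨n, hn, h⟩ := (isOfFinOrder_of_finite (Units.mk0 a ha)).exists_pow_eq_one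
  have h1 : a ^ n = 1 := by simpa using congrArg Units.val h
  have h2 : v (f a) ^ n = 1 := by rw [← map_pow, ← map_pow, h1, map_one, map_one]
  exact (pow_eq_one_iff_of_nonneg zero_le hn.ne').1 h2

lemma closure_eq_top_of_adjoin {R S : Type*} [Field R] [Field S] [Algebra R S] {T : Set S}
    (hT : IntermediateField.adjoin R T = ⊤) :
    Subfield.closure (Set.range (algebraMap R S) ∪ T) = ⊤ := by
  rw [← IntermediateField.adjoin_toSubfield, hT]
  rfl

/-- Every valuation on a global field has finitely generated value group and residue field. In
positive characteristic, unless the valuation is trivial, any element of nontrivial value is a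
transcendence basis over the finite field of constants. -/
lemma hasFGInvariants_of_isGlobalField {k : Type*} [Field k] (hk : IsGlobalField k) (f : k →+* K) :
    v.HasFGInvariants f.fieldRange := by
  obtain hk | ⟨F, hF, ⟨T, hT⟩, htr⟩ := hk
  · obtain ⟨w, hw⟩ := exists_isTranscendenceBasis ℚ k
    have : IsEmpty w := hw.isEmpty_iff_isAlgebraic.2 inferInstance
    refine (hasFGInvariants_bot v).of_isTranscendenceBasis
      (IntermediateField.fg_of_noetherian _) hw f (fun r => ?_) isEmptyElim
    rw [eq_ratCast, map_ratCast]
    exact SubfieldClass.ratCast_mem _ r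
  have hclos := closure_eq_top_of_adjoin hT
  by_cases htriv : ∀ a : k, a ≠ 0 → v (f a) = 1
  · exact hasFGInvariants_of_trivial f ((Set.finite_range _).union T.finite_toSet) hclos htriv
  push Not at htriv
  obtain ⟨t, ht0, ht⟩ := htriv
  let g : F →+* K := f.comp (algebraMap F k)
  have hvF : ∀ a : F, a ≠ 0 → v (g a) = 1 := fun a ha => eq_one_of_finite g ha
  have hFG : v.HasFGInvariants g.fieldRange :=
    hasFGInvariants_of_trivial g Set.finite_univ (T := Set.univ) Subfield.closure_univ hvF
  have hft : v (f t) ≠ 0 := v.ne_zero_iff.2 ((map_ne_zero f).2 ht0)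
  -- a nontrivial value has infinite order, so it is independent of the trivial values on `F`
  have htors : ∀ n : ℤ, v (f t) ^ n = 1 → n = 0 := fun n hn => by
    by_contra h0
    exact h0 ((zpow_eq_one_iff_right₀ zero_le ht).1 hn)
  let x : Unit → Kˣ := fun _ => Units.mk0 (f t) ((map_ne_zero f).2 ht0)
  have hx : ∀ e : Unit → ℤ, ∏ i, (Units.map (v : K →* Γ₀) (x i)) ^ e i ∈
      v.valueSubgroup g.fieldRange → ∀ i, e i = 0 := by
    rintro e ⟨_, ⟨a, rfl⟩, ha⟩ ⟨⟩
    refine htors _ ?_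
    have h1 : v (g a) = v (f t) ^ e () := by simpa [x] using ha
    rw [← h1]
    refine hvF a ?_
    rintro rfl
    rw [map_zero, map_zero] at h1
    exact zpow_ne_zero _ hft h1.symm
  obtain ⟨-, -, hind⟩ := adjoin_of_value_independent (v := v) x Finset.univ
    fun e he i _ => hx e he i
  have hind' : AlgebraicIndependent g.fieldRange (f ∘ fun _ : Unit => t) :=
    hind.comp (fun i => ⟨i, by simp⟩) fun _ _ _ => rfl
  have hindF : AlgebraicIndependent F (fun _ : Unit => t) :=
    hind'.of_ringHom_of_comp_eq g.rangeRestrictField f g.rangeRestrictField.injective rfl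
  have hw : IsTranscendenceBasis F (fun _ : Unit => t) :=
    hindF.isTranscendenceBasis_of_lift_trdeg_le_of_finite (by simp [htr])
  refine (hFG.adjoin_value_independent x hx).of_isTranscendenceBasis ⟨T, hT⟩ hw f (fun r => ?_)
    (fun i => ?_)
  · exact Subfield.subset_closure (Or.inl ⟨r, rfl⟩)
  · exact Subfield.subset_closure (Or.inr ⟨(), rfl⟩)

/-! ### Abhyankar valuations -/

lemma valueGroup_eq_valueSubgroup :
    MonoidWithZeroHom.valueGroup (.ofClass v : K →*₀ Γ₀) = v.valueSubgroup ⊤ := by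
  ext γ
  rw [mem_valueSubgroup, MonoidWithZeroHom.mem_valueGroup_iff_of_comm]
  constructor
  · rintro ⟨a, ha, b, hb⟩
    refine ⟨b / a, trivial, ?_⟩
    rw [map_div₀]
    exact (div_eq_iff ha).2 (hb.symm.trans (mul_comm _ _))
  · rintro ⟨l, -, hl⟩
    exact ⟨1, by simp, l, by simpa using hl.symm⟩

lemma valueGroup_comap {k : Type*} [Field k] [Algebra k K] :
    MonoidWithZeroHom.valueGroup (.ofClass (v.comap (algebraMap k K)) : k →*₀ Γ₀) =
      v.valueSubgroup (algebraMap k K).fieldRange := by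
  rw [valueGroup_eq_valueSubgroup]
  ext γ
  constructor
  · rintro ⟨l, -, hl⟩
    exact ⟨_, ⟨l, rfl⟩, hl⟩
  · rintro ⟨_, ⟨l, rfl⟩, hl⟩
    exact ⟨l, trivial, hl⟩

end Valuation

open scoped TensorProduct in
/-- A group of rational rank `r` contains `r` independent elements. -/
lemma exists_independent_of_rationalRank_eq {G : Type*} [CommGroup G] {r : ℕ}
    (h : rationalRank G = r) :
    ∃ g : Fin r → G, ∀ e : Fin r → ℤ, ∏ i, g i ^ e i = 1 → ∀ i, e i = 0 := by
  have hr : Module.rank ℚ (ℚ ⊗[ℤ] Additive G) = r := by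
    have := Cardinal.toENat_eq_natCast.1 h
    exact this
  let φ : Additive G → ℚ ⊗[ℤ] Additive G := fun g => 1 ⊗ₜ g
  have hspan : Submodule.span ℚ (Set.range φ) = ⊤ := by
    rw [eq_top_iff]
    rintro z -
    induction z using TensorProduct.induction_on with
    | zero => exact zero_mem _
    | tmul q g =>
      have : q ⊗ₜ[ℤ] g = q • φ g := by simp [φ, TensorProduct.smul_tmul']
      rw [this]
      exact Submodule.smul_mem _ _ (Submodule.subset_span ⟨g, rfl⟩)
    | add x y hx hy => exact add_mem hx hy
  obtain ⟨b, hb, hbs, hli⟩ := exists_linearIndependent ℚ (Set.range φ)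
  let B := Module.Basis.mk hli (by rw [Subtype.range_coe, hbs, hspan])
  have hcard : Cardinal.mk b = r := by rw [← hr, B.mk_eq_rank'']
  obtain ⟨e⟩ : Nonempty (Fin r ≃ b) := by
    refine Cardinal.lift_mk_eq'.1 ?_
    simp [hcard]
  choose g hg using fun i => hb (e i).2
  refine ⟨fun i => (g i).toMul, fun c hc i => ?_⟩
  have h1 : ∑ i, c i • g i = 0 := by
    have := congrArg Additive.ofMul hc
    simpa using this
  have h2 : ∑ i, (c i : ℚ) • ((e i : b) : ℚ ⊗[ℤ] Additive G) = 0 := by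
    have h3 : ∀ i, (c i : ℚ) • ((e i : b) : ℚ ⊗[ℤ] Additive G) =
        TensorProduct.mk ℤ ℚ (Additive G) 1 (c i • g i) := fun i => by
      rw [← hg i, map_smul, TensorProduct.mk_apply]
      simp [φ, Int.cast_smul_eq_zsmul]
    simp_rw [h3]
    rw [← map_sum, h1, map_zero]
  have h4 := Fintype.linearIndependent_iff.1 (hli.comp e e.injective) (fun i => (c i : ℚ)) h2 i
  exact_mod_cast h4

namespace Valuation

open IsLocalRing Polynomial

variable {K Γ₀ : Type*} [Field K] [LinearOrderedCommGroupWithZero Γ₀] {v : Valuation K Γ₀}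

/-- An Abhyankar valuation on a function field over `k` has finitely generated value group and
residue field if this holds for its restriction to `k`: elements with independent values and
residues that attain the Abhyankar bound form a transcendence basis. -/
lemma IsAbhyankar.hasFGInvariants {k : Type*} [Field k] [Algebra k K]
    (hK : IsFunctionFieldOver k K) (hv : v.IsAbhyankar k)
    (hk : v.HasFGInvariants (algebraMap k K).fieldRange) : v.HasFGInvariants ⊤ := by
  have hfin : Algebra.trdeg k K < Cardinal.aleph0 := by
    have : Algebra.EssFiniteType k K := IntermediateField.fg_top_iff.1 hK
    exact trdeg_lt_aleph0 k K
  obtain ⟨n, hn⟩ := Cardinal.lt_aleph0.1 hfin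
  rw [IsAbhyankar, etrdeg, hn, map_natCast] at hv
  obtain ⟨r, hr⟩ := ENat.ne_top_iff_exists.1 (fun h => by
    rw [h, top_add] at hv; exact ENat.natCast_ne_top _ hv :
    rationalRank (MonoidWithZeroHom.valueGroup (.ofClass v) ⧸ v.restrictedValueGroup k) ≠ ⊤)
  obtain ⟨s, hs⟩ := ENat.ne_top_iff_exists.1 (fun h => by
    rw [h, add_top] at hv; exact ENat.natCast_ne_top _ hv :
    etrdeg (ResidueField (v.comap (algebraMap k K)).valuationSubring)
        (ResidueField v.valuationSubring) ≠ ⊤)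
  rw [← hr, ← hs] at hv
  have hnrs : n = r + s := by exact_mod_cast hv
  -- elements with values independent modulo the value group of `k`
  obtain ⟨g, hg⟩ := exists_independent_of_rationalRank_eq hr.symm
  choose γ hγ using fun i => QuotientGroup.mk_surjective (g i)
  have hx : ∀ i, ∃ x : Kˣ, Units.map (v : K →* Γ₀) x = γ i := fun i => by
    have hmem : (γ i : Γ₀ˣ) ∈ v.valueSubgroup ⊤ := valueGroup_eq_valueSubgroup (v := v) ▸ (γ i).2
    obtain ⟨l, -, hl⟩ := hmem
    exact ⟨Units.mk0 l (v.ne_zero_iff.1 (by simp [hl])), Units.ext hl⟩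
  choose x hx using hx
  have hxind : ∀ e : Fin r → ℤ, ∏ i, (Units.map (v : K →* Γ₀) (x i)) ^ e i ∈
      v.valueSubgroup (algebraMap k K).fieldRange → ∀ i, e i = 0 := by
    intro e he
    refine hg e ?_
    have h1 : ∏ i, γ i ^ e i ∈ v.restrictedValueGroup k := by
      rw [restrictedValueGroup, Subgroup.mem_subgroupOf, valueGroup_comap]
      push_cast
      simpa only [hx] using he
    rw [← (QuotientGroup.eq_one_iff _).2 h1]
    simp only [← hγ]
    exact (map_prod (QuotientGroup.mk' (v.restrictedValueGroup k)) (fun i => γ i ^ e i) _).symm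
  -- elements with residues algebraically independent over the residue field of `k`
  obtain ⟨t, ht⟩ := exists_isTranscendenceBasis
    (ResidueField (v.comap (algebraMap k K)).valuationSubring) (ResidueField v.valuationSubring)
  have htcard : Cardinal.mk t = s := by
    rw [ht.cardinalMk_eq_trdeg]
    exact Cardinal.toENat_eq_natCast.1 hs.symm
  have htfin : Finite t := Cardinal.lt_aleph0_iff_finite.1 (htcard ▸ Cardinal.natCast_lt_aleph0)
  have := Fintype.ofFinite t
  choose y hy using fun i : t => residue_surjective (R := v.valuationSubring) i
  set L := (algebraMap k K).fieldRange with hL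
  have hmem : ∀ a, algebraMap (ResidueField (v.comap (algebraMap k K)).valuationSubring)
      (ResidueField v.valuationSubring) a ∈ v.residueSubfield L := by
    intro a
    obtain ⟨a, rfl⟩ := residue_surjective a
    exact ⟨algebraMap _ _ a, ⟨a, rfl⟩, rfl⟩
  have hyind : AlgebraicIndependent (v.residueSubfield L) fun i => residue _ (y i) := by
    let φ : ResidueField (v.comap (algebraMap k K)).valuationSubring →+* v.residueSubfield L :=
      (algebraMap _ _).codRestrict _ hmem
    have hφ : Function.Surjective φ := by
      rintro ⟨_, l, ⟨a, ha⟩, rfl⟩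
      have hav : v (algebraMap k K a) ≤ 1 := ha ▸ l.2
      refine ⟨residue _ ⟨a, hav⟩, Subtype.ext ?_⟩
      exact congrArg (residue v.valuationSubring) (Subtype.ext ha)
    have := ht.1.ringHom_of_comp_eq φ (RingHom.id _) hφ (RingHom.id _).injective rfl
    simpa only [hy] using! this
  have hM₁ := hk.adjoin_value_independent x hxind
  obtain ⟨hres, -, hindx⟩ := adjoin_of_value_independent (v := v) x Finset.univ
    fun e he i _ => hxind e he i
  rw [Finset.coe_univ, Set.image_univ] at hres
  set M₁ := Subfield.closure ((L : Set K) ∪ Set.range fun i => (x i : K)) with hM₁def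
  have hM₂ := hM₁.adjoin_residue_independent hres hk.2 y hyind
  obtain ⟨-, -, hindy⟩ := adjoin_of_residue_independent hres y hyind Finset.univ
  have hLM : L ≤ M₁ := fun a ha => Subfield.subset_closure (Or.inl ha)
  let _ : Algebra L M₁ := (Subfield.inclusion hLM).toAlgebra
  have : IsScalarTower L M₁ K := .of_algebraMap_eq fun _ => rfl
  have hindx' : AlgebraicIndependent L fun i => (x i : K) :=
    hindx.comp (fun i => ⟨i, by simp⟩) fun _ _ h => by simpa using h
  have hindy' : AlgebraicIndependent M₁ fun i => (y i : K) :=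
    hindy.comp (fun i => ⟨i, by simp⟩) fun _ _ h => by simpa using h
  have hind : AlgebraicIndependent L (Sum.elim (fun i => (y i : K)) fun i => (x i : K)) := by
    refine hindx'.sumElim_of_tower (S := M₁) ?_ hindy'
    rintro _ ⟨i, rfl⟩
    exact ⟨⟨x i, Subfield.subset_closure (Or.inr ⟨i, rfl⟩)⟩, rfl⟩
  have hindk : AlgebraicIndependent k (Sum.elim (fun i => (y i : K)) fun i => (x i : K)) :=
    AlgebraicIndependent.of_ringHom_of_comp_eq (algebraMap k K).rangeRestrictField (RingHom.id K)
      hind (algebraMap k K).rangeRestrictField.injective rfl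
  have hw := hindk.isTranscendenceBasis_of_lift_trdeg_le_of_finite (by
    rw [Cardinal.mk_sum, htcard, hn, hnrs]
    simp [add_comm])
  have := hM₂.of_isTranscendenceBasis hK hw (RingHom.id K)
    (fun a => Subfield.subset_closure (Or.inl (hLM ⟨a, rfl⟩))) (fun i => ?_)
  · rwa [show (RingHom.id K).fieldRange = ⊤ from RingHom.fieldRange_eq_top_iff.2 fun a => ⟨a, rfl⟩]
      at this
  · cases i with
    | inl i => exact Subfield.subset_closure (Or.inr ⟨i, rfl⟩)
    | inr i => exact Subfield.subset_closure (Or.inl (Subfield.subset_closure (Or.inr ⟨i, rfl⟩)))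

end Valuation

/-! ### Discrete valuations of a finitely generated field -/

open Polynomial

/-- `π` is a uniformizer of `W`, whose value group is then infinite cyclic. -/
def ValuationSubring.IsUniformizer {F : Type*} [Field F] (W : ValuationSubring F) (π : F) : Prop :=
  π ≠ 0 ∧ W.valuation π < 1 ∧ ∀ z : F, z ≠ 0 → ∃ n : ℤ, W.valuation z = W.valuation π ^ n

/-- Every nonzero element of `F` is a square in the residue field of some discrete valuation ring of
`F`, whose valuation can moreover be chosen trivial on a given finite set of nonzero elements. -/
def HasSplitPlaces (F : Type*) [Field F] : Prop :=
  ∀ a : F, a ≠ 0 → ∀ S : Finset F, 0 ∉ S → ∃ (W : ValuationSubring F) (π : F), W.IsUniformizer π ∧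
    (∀ s ∈ S, W.valuation s = 1) ∧ ∃ x, W.valuation (x ^ 2 - a) < 1

/-- A value group stays cyclic in a finite extension `F` of `L`: it is torsion-free, and raising to
a suitable power embeds it into the value group of `L`. -/
lemma isCyclic_valueSubgroup_of_finiteDimensional {F Γ₀ : Type*} [Field F]
    [LinearOrderedCommGroupWithZero Γ₀] {v : Valuation F Γ₀} (L : Subfield F)
    [FiniteDimensional L F] {g : Γ₀ˣ} (hg : v.valueSubgroup L ≤ Subgroup.zpowers g) :
    IsCyclic (v.valueSubgroup ⊤) := by
  have h := Valuation.relIndex_valueSubgroup_ne_zero (v := v) (⊤ : IntermediateField L F)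
  set N := v.valueSubgroup ⊤
  set n := ((v.valueSubgroup L).relIndex N).factorial
  have hpow : ∀ γ ∈ N, γ ^ n ∈ Subgroup.zpowers g := fun γ hγ => hg
    (Subgroup.pow_mem_of_relIndex_ne_zero_of_dvd h hγ fun m h0 hm => Nat.dvd_factorial h0 hm).1
  let φ : N →* Subgroup.zpowers g :=
    ((powMonoidHom n).comp N.subtype).codRestrict _ fun γ => hpow γ γ.2
  refine isCyclic_of_injective φ fun a b hab => Subtype.ext ?_
  exact pow_left_injective (Nat.factorial_ne_zero _) (congrArg Subtype.val hab)

/-- If `1 - a (d z)²` is not a unit of the integral closure of `A`, then at a place above it `a` is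
congruent to the square of `1 / (d z)`. Taking for `d` a common denominator makes the place trivial
on a given finite set. -/
lemma exists_place_of_not_isIntegral {A F : Type*} [CommRing A] [IsDomain A]
    [IsPrincipalIdealRing A] [Field F] [Algebra A F] [Algebra.IsAlgebraic A F] (L : Subfield F)
    [FiniteDimensional L F] (hL : ∀ z ∈ L, ∃ a b : A, z = algebraMap A F a / algebraMap A F b)
    {a : F}
    (hb : ∀ d : A, d ≠ 0 → ∃ z : A, ¬ IsIntegral A (1 - a * algebraMap A F (d * z) ^ 2)⁻¹)
    (S : Finset F) (hS : 0 ∉ S) : ∃ (W : ValuationSubring F) (π : F), W.IsUniformizer π ∧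
    (∀ s ∈ S, W.valuation s = 1) ∧ ∃ x, W.valuation (x ^ 2 - a) < 1 := by
  classical
  obtain ⟨d, hd0, hd⟩ := Algebra.IsAlgebraic.exists_integral_multiples A
    (insert a S ∪ S.image fun s => s⁻¹)
  obtain ⟨z, hz⟩ := hb d hd0
  set b := 1 - a * algebraMap A F (d * z) ^ 2
  obtain ⟨W, hW, hbW⟩ := Subring.exists_le_valuationSubring_of_isIntegrallyClosedIn
    (R := (integralClosure A F).toSubring) (x := b⁻¹) hz
  set w := W.valuation
  have hint : ∀ x : F, IsIntegral A x → w x ≤ 1 := fun x hx => (W.valuation_le_one_iff x).2 (hW hx)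
  have hb0 : b ≠ 0 := by
    intro h
    rw [h, inv_zero] at hbW
    exact hbW W.zero_mem
  have hwb : w b < 1 := by
    rw [← W.valuation_le_one_iff, map_inv₀, not_le] at hbW
    exact (one_lt_inv₀ (zero_lt_iff.2 (w.ne_zero_iff.2 hb0))).1 hbW
  have hwA : ∀ c : A, w (algebraMap A F c) ≤ 1 := fun c => hint _ isIntegral_algebraMap
  have hwad : w (algebraMap A F d * a) ≤ 1 := hint _ (by
    have := hd a (by simp)
    rwa [Algebra.smul_def] at this)
  have h1 : w (a * algebraMap A F (d * z) ^ 2) = 1 := by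
    have : a * algebraMap A F (d * z) ^ 2 = 1 - b := by simp [b]
    rw [this, w.map_one_sub_of_lt hwb]
  have hwdz : w (algebraMap A F (d * z)) = 1 ∧ w (algebraMap A F d) = 1 := by
    have hmul : ∀ x y : W.ValueGroup, x ≤ 1 → y ≤ 1 → x * y = 1 → x = 1 := fun x y hx hy h =>
      le_antisymm hx (h ▸ mul_le_of_le_one_right' hy)
    have h2 : w (algebraMap A F d) * w (algebraMap A F z) ^ 2 * w (algebraMap A F d * a) = 1 := by
      rw [← h1, map_mul (algebraMap A F), ← map_pow, ← map_mul, ← map_mul]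
      congr 1
      ring
    have h3 : w (algebraMap A F d) * w (algebraMap A F z) ^ 2 = 1 :=
      hmul _ _ (mul_le_one' (hwA d) (pow_le_one' (hwA z) 2)) hwad h2
    have h4 : w (algebraMap A F d) = 1 := hmul _ _ (hwA d) (pow_le_one' (hwA z) 2) h3
    rw [h4, one_mul] at h3
    refine ⟨?_, h4⟩
    rw [map_mul, map_mul, h4, one_mul]
    exact (pow_eq_one_iff_of_nonneg zero_le two_ne_zero).1 h3
  have hle : ∀ s ∈ insert a S ∪ S.image (fun s => s⁻¹), w s ≤ 1 := fun s hs => by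
    have := hint _ (hd s hs)
    rwa [Algebra.smul_def, map_mul, hwdz.2, one_mul] at this
  obtain ⟨g, hg⟩ := Valuation.exists_valueSubgroup_le_zpowers (v := w) (algebraMap A F) hwA hL
  have hcyc := isCyclic_valueSubgroup_of_finiteDimensional L hg
  obtain ⟨⟨γ, hγ⟩, hgen⟩ := hcyc.exists_generator
  have hgen' : ∀ z : F, z ≠ 0 → ∃ n : ℤ, w z = (γ : W.ValueGroup) ^ n := fun z hz => by
    obtain ⟨n, hn⟩ := hgen ⟨_, Valuation.mk0_mem_valueSubgroup (L := ⊤) trivial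
      (w.ne_zero_iff.2 hz)⟩
    refine ⟨n, ?_⟩
    have := congrArg (fun c : w.valueSubgroup ⊤ => ((c : W.ValueGroupˣ) : W.ValueGroup)) hn
    simpa using this.symm
  obtain ⟨π, -, hπ⟩ := hγ
  have hπ0 : π ≠ 0 := w.ne_zero_iff.1 (by rw [hπ]; exact γ.ne_zero)
  have hunif : ∃ π, W.IsUniformizer π := by
    rw [← hπ] at hgen'
    rcases lt_trichotomy (w π) 1 with h | h | h
    · exact ⟨π, hπ0, h, hgen'⟩
    · obtain ⟨n, hn⟩ := hgen' b hb0
      rw [h, one_zpow] at hn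
      exact absurd hn hwb.ne
    · refine ⟨π⁻¹, inv_ne_zero hπ0, ?_, fun z hz => ?_⟩
      · change w π⁻¹ < 1
        rw [map_inv₀]
        exact inv_lt_one_of_one_lt₀ h
      · obtain ⟨n, hn⟩ := hgen' z hz
        exact ⟨-n, by change _ = w π⁻¹ ^ _; rw [map_inv₀, inv_zpow', neg_neg, ← hn]⟩
  obtain ⟨π, hπ⟩ := hunif
  refine ⟨W, π, hπ, fun s hs => le_antisymm (hle s (by simp [hs])) ?_,
    (algebraMap A F (d * z))⁻¹, ?_⟩
  · have h5 := hle s⁻¹ (Finset.mem_union_right _ (Finset.mem_image_of_mem _ hs))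
    rw [map_inv₀] at h5
    exact (inv_le_one₀ (zero_lt_iff.2 (w.ne_zero_iff.2 (by rintro rfl; exact hS hs)))).1 h5
  · have hdz0 : algebraMap A F (d * z) ≠ 0 := w.ne_zero_iff.1 (by rw [hwdz.1]; simp)
    have : (algebraMap A F (d * z))⁻¹ ^ 2 - a = b * (algebraMap A F (d * z))⁻¹ ^ 2 := by
      simp only [b]
      field_simp
    rw [this]
    change w _ < 1
    rw [map_mul, map_pow, map_inv₀, hwdz.1, inv_one, one_pow, mul_one]
    exact hwb

/-- In a number field, `1 - a d² z²` is not a unit once the integer `z` is so large that all its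
conjugates have absolute value greater than `1`. -/
lemma exists_not_isIntegral_of_finiteDimensional_rat {F : Type*} [Field F] [CharZero F]
    [FiniteDimensional ℚ F] {a : F} (ha : a ≠ 0) {d : ℤ} (hd : d ≠ 0) :
    ∃ z : ℤ, ¬ IsIntegral ℤ (1 - a * algebraMap ℤ F (d * z) ^ 2)⁻¹ := by
  obtain ⟨z, hz⟩ : ∃ z : ℕ, ∀ σ : F →ₐ[ℚ] ℂ, 3 ≤ ‖σ (a * (d : F) ^ 2)‖ * z := by
    obtain ⟨z, hz⟩ := exists_nat_ge (∑ σ : F →ₐ[ℚ] ℂ, 3 / ‖σ (a * (d : F) ^ 2)‖)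
    refine ⟨z, fun σ => ?_⟩
    have hpos : 0 < ‖σ (a * (d : F) ^ 2)‖ := by
      rw [norm_pos_iff]
      exact (map_ne_zero σ).2 (mul_ne_zero ha (pow_ne_zero _ (by exact_mod_cast hd)))
    have h := (Finset.single_le_sum (f := fun σ : F →ₐ[ℚ] ℂ => 3 / ‖σ (a * (d : F) ^ 2)‖)
      (fun i _ => by positivity) (Finset.mem_univ σ)).trans hz
    rwa [div_le_iff₀ hpos, mul_comm] at h
  refine ⟨z, fun hint => ?_⟩
  set b := 1 - a * algebraMap ℤ F (d * z) ^ 2 with hb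
  have hnorm : ∀ σ : F →ₐ[ℚ] ℂ, 2 ≤ ‖σ b‖ := fun σ => by
    have h1 : σ b = 1 - σ (a * (d : F) ^ 2) * (z : ℂ) ^ 2 := by
      simp only [hb, map_sub, map_mul, map_pow, map_one, eq_intCast, map_intCast]
      push_cast
      ring
    have hz1 : (1 : ℝ) ≤ z := by
      have h2 := hz σ
      rcases Nat.eq_zero_or_pos z with h | h
      · rw [h] at h2; norm_num at h2
      · exact_mod_cast h
    have h3 := norm_sub_norm_le (σ (a * (d : F) ^ 2) * (z : ℂ) ^ 2) 1
    rw [norm_mul, norm_pow, Complex.norm_natCast, norm_one] at h3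
    rw [h1, norm_sub_rev]
    nlinarith [hz σ]
  have hN : IsIntegral ℤ (Algebra.norm ℚ b⁻¹) := Algebra.isIntegral_norm ℚ hint
  obtain ⟨m, hm⟩ := IsIntegrallyClosed.isIntegral_iff.1 hN
  have hprod := Algebra.norm_eq_prod_embeddings ℚ ℂ b⁻¹
  rw [← hm] at hprod
  have hlt : ‖∏ σ : F →ₐ[ℚ] ℂ, σ b⁻¹‖ < 1 := by
    rw [norm_prod]
    refine (Finset.prod_le_prod (g := fun _ => (1 / 2 : ℝ)) (fun _ _ => norm_nonneg _)
      fun σ _ => ?_).trans_lt ?_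
    · rw [map_inv₀, norm_inv, one_div]
      exact inv_anti₀ two_pos (hnorm σ)
    · rw [Finset.prod_const]
      refine pow_lt_one₀ (by norm_num) (by norm_num) ?_
      rw [Finset.card_univ, AlgHom.card]
      exact Module.finrank_pos.ne'
  rw [← hprod] at hlt
  have hm0 : m = 0 := by
    have : |(m : ℝ)| < 1 := by simpa using hlt
    have h4 : |m| < 1 := by exact_mod_cast this
    exact Int.abs_lt_one_iff.1 h4
  rw [hm0, map_zero, eq_comm, Algebra.norm_eq_zero_iff, inv_eq_zero] at hm
  have hne : Nonempty (F →ₐ[ℚ] ℂ) := Fintype.card_pos_iff.1 (by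
    rw [AlgHom.card]; exact Module.finrank_pos)
  have := hnorm hne.some
  rw [hm, map_zero, norm_zero] at this
  norm_num at this

/-- A nonconstant polynomial in a transcendental element `t` is not a unit over `E[t]`. -/
lemma not_isIntegral_inv_aeval {E F : Type*} [Field E] [Field F] [Algebra E F] {t : F}
    (ht : Transcendental E t) {q : E[X]} (hq : 0 < q.degree) :
    letI : Algebra E[X] F := (aeval t).toAlgebra
    ¬ IsIntegral E[X] (aeval t q)⁻¹ := by
  let _ : Algebra E[X] F := (aeval t).toAlgebra
  intro hint
  have hinj : Function.Injective (algebraMap E[X] F) := transcendental_iff_injective.1 ht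
  have : FaithfulSMul E[X] F := (faithfulSMul_iff_algebraMap_injective _ _).2 hinj
  let φ : FractionRing E[X] →ₐ[E[X]] F := IsFractionRing.liftAlgHom (g := Algebra.ofId E[X] F) hinj
  have h1 : (aeval t q)⁻¹ = φ (algebraMap E[X] (FractionRing E[X]) q)⁻¹ := by
    rw [map_inv₀, AlgHom.commutes]
    rfl
  rw [h1, isIntegral_algHom_iff φ φ.toRingHom.injective] at hint
  obtain ⟨p, hp⟩ := IsIntegrallyClosed.isIntegral_iff.1 hint
  have hq0 : algebraMap E[X] (FractionRing E[X]) q ≠ 0 := by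
    rw [Ne, FaithfulSMul.algebraMap_eq_zero_iff]
    rintro rfl
    simp at hq
  have h2 : p * q = 1 := by
    apply FaithfulSMul.algebraMap_injective E[X] (FractionRing E[X])
    rw [map_mul, hp, inv_mul_cancel₀ hq0, map_one]
  exact hq.ne' (degree_eq_zero_of_isUnit (IsUnit.of_mul_eq_one_right _ h2))

lemma finiteDimensional_of_closure_eq_top {F : Type*} [Field F] {T : Set F} (hT : T.Finite)
    (hTF : Subfield.closure T = ⊤) (L : Subfield F) (halg : ∀ z : F, IsAlgebraic L z) :
    FiniteDimensional L F := by
  have : Finite T := hT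
  have h1 : FiniteDimensional L (IntermediateField.adjoin L T) :=
    IntermediateField.finiteDimensional_adjoin fun x _ => (halg x).isIntegral
  have h2 : IntermediateField.adjoin L T = ⊤ := by
    rw [eq_top_iff]
    intro z _
    have hz : z ∈ Subfield.closure T := hTF ▸ Subfield.mem_top z
    exact (Subfield.closure_le (t := (IntermediateField.adjoin L T).toSubfield)).2
      (IntermediateField.subset_adjoin L T) hz
  rw [h2] at h1
  exact IntermediateField.topEquiv.toLinearEquiv.finiteDimensional

/-- Up to a square factor, every nonzero element is transcendental. -/
lemma exists_transcendental_mul_sq {P F : Type*} [Field P] [Field F] [Algebra P F]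
    (h : ¬ Algebra.IsAlgebraic P F) {a : F} (ha : a ≠ 0) :
    ∃ s : F, s ≠ 0 ∧ Transcendental P (a * s ^ 2) := by
  by_cases hat : IsAlgebraic P a
  · rw [Algebra.isAlgebraic_def] at h
    push Not at h
    obtain ⟨τ, hτ⟩ := h
    have hτ0 : τ ≠ 0 := by rintro rfl; exact hτ isAlgebraic_zero
    refine ⟨τ, hτ0, fun halg => hτ ?_⟩
    have h1 : IsAlgebraic P (τ ^ 2) := by
      have := hat.inv.mul halg
      rwa [inv_mul_cancel_left₀ ha] at this
    exact h1.of_pow two_pos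
  · exact ⟨1, one_ne_zero, by simpa using! hat⟩

/-- A transcendental element `t` is a square modulo a prime factor of `1 - t d²`. -/
lemma exists_place_of_transcendental {F : Type*} [Field F] {T : Set F} (hT : T.Finite)
    (hTF : Subfield.closure T = ⊤) {t : F} (ht : Transcendental (⊥ : Subfield F) t)
    (S : Finset F) (hS : 0 ∉ S) : ∃ (W : ValuationSubring F) (π : F), W.IsUniformizer π ∧
    (∀ s ∈ S, W.valuation s = 1) ∧ ∃ x, W.valuation (x ^ 2 - t) < 1 := by
  obtain ⟨B, htB, hB⟩ := exists_isTranscendenceBasis_superset (R := (⊥ : Subfield F)) (s := {t})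
    ((algebraicIndependent_unique_type_iff (R := (⊥ : Subfield F))
      (x := fun i : ({t} : Set F) => (i : F))).2 ht)
  have htB' : t ∈ B := htB rfl
  let E : Subfield F := Subfield.closure (((⊥ : Subfield F) : Set F) ∪ (B \ {t}))
  have hBins : insert t (B \ {t}) = B := Set.insert_sdiff_self_of_mem htB'
  have htE : Transcendental E t := by
    have hon : AlgebraicIndepOn (⊥ : Subfield F) id (insert t (B \ {t})) := by
      rw [hBins]; exact hB.1
    have h1 := ((AlgebraicIndepOn.insert_iff (by simp)).1 hon).2
    rw [Set.image_id] at h1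
    exact Valuation.transcendental_of_adjoin le_rfl h1
  let L : Subfield F := Subfield.closure (insert t (E : Set F))
  have hLB : L = Subfield.closure (((⊥ : Subfield F) : Set F) ∪ B) := by
    conv_rhs => rw [← hBins, Valuation.insert_closure_le]
  have hLE : L = Subfield.closure ((E : Set F) ∪ {t}) := by
    rw [Set.union_comm, Set.singleton_union]
  have halgL : ∀ z : F, IsAlgebraic L z := fun z => by
    by_contra hz
    have h1 : Transcendental (Algebra.adjoin (⊥ : Subfield F) B) z :=
      Valuation.transcendental_adjoin_of_closure (hLB ▸ hz)
    have h2 := hB.isAlgebraic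
    rw [Subtype.range_coe] at h2
    exact h1 (h2.isAlgebraic z)
  have := finiteDimensional_of_closure_eq_top hT hTF L halgL
  let _ : Algebra E[X] F := (aeval t).toAlgebra
  have halgA : Algebra.IsAlgebraic E[X] F := ⟨fun z => by
    have h1 : IsAlgebraic (Algebra.adjoin E {t}) z := by
      by_contra hz
      exact Valuation.transcendental_of_adjoin le_rfl hz (hLE ▸ halgL z)
    let f : E[X] →+* Algebra.adjoin E {t} := (aeval (⟨t, Algebra.self_mem_adjoin_singleton E t⟩ :
      Algebra.adjoin E {t})).toRingHom
    have hf : ∀ p : E[X], (f p : F) = aeval t p := fun p =>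
      (aeval_algebraMap_apply F (⟨t, Algebra.self_mem_adjoin_singleton E t⟩ :
        Algebra.adjoin E {t}) p).symm
    refine IsAlgebraic.of_ringHom_of_comp_eq f (RingHom.id F) h1 (fun z => ?_)
      (RingHom.id F).injective (RingHom.ext hf)
    obtain ⟨p, hp⟩ := (Algebra.adjoin_singleton_eq_range_aeval E t).le z.2
    exact ⟨p, Subtype.ext ((hf p).trans hp)⟩⟩
  refine exists_place_of_not_isIntegral (A := E[X]) L
    (fun z hz => Valuation.exists_aeval_div_of_mem_closure_insert hz) (fun d hd => ⟨1, ?_⟩) S hS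
  have hmap : ∀ p : E[X], algebraMap E[X] F p = aeval t p := fun _ => rfl
  have hdeg : 0 < (1 - X * d ^ 2 : E[X]).degree := by
    have h1 : 0 < (X * d ^ 2 : E[X]).degree := by
      rw [degree_mul, degree_X, degree_pow]
      have : 0 ≤ d.degree := zero_le_degree_iff.2 hd
      calc (0 : WithBot ℕ) < 1 := zero_lt_one
        _ ≤ 1 + 2 • d.degree := le_add_of_nonneg_right (nsmul_nonneg this 2)
    rw [degree_sub_eq_right_of_degree_lt (by simpa using h1)]
    exact h1
  have h2 := not_isIntegral_inv_aeval htE hdeg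
  convert! h2 using 3
  rw [hmap, map_sub, map_one, map_mul (aeval t) X, map_pow, aeval_X, mul_one]

lemma finite_of_isAlgebraic_bot {F : Type*} [Field F] {p : ℕ} [CharP F p] (hp : p ≠ 0)
    {T : Set F} (hT : T.Finite) (hTF : Subfield.closure T = ⊤)
    (halg : Algebra.IsAlgebraic (⊥ : Subfield F) F) : Finite F := by
  have : Fact p.Prime := ⟨(CharP.char_is_prime_or_zero F p).resolve_right hp⟩
  have := finiteDimensional_of_closure_eq_top hT hTF ⊥ halg.isAlgebraic
  let _ := ZMod.algebra F p
  have : Finite (⊥ : Subfield F) := by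
    rw [Subfield.bot_eq_of_zMod_algebra p]
    exact Set.finite_range _
  exact Module.finite_of_finite (⊥ : Subfield F)

/-- A finitely generated infinite field has places at which a given element is a square. -/
theorem hasSplitPlaces_of_fg {F : Type*} [Field F] [Infinite F] {T : Set F} (hT : T.Finite)
    (hTF : Subfield.closure T = ⊤) : HasSplitPlaces F := by
  classical
  intro a ha S hS
  by_cases halg : Algebra.IsAlgebraic (⊥ : Subfield F) F
  · rcases CharP.exists F with ⟨p, hp⟩
    rcases CharP.char_is_prime_or_zero F p with hprime | rfl
    · exact absurd (finite_of_isAlgebraic_bot hprime.ne_zero hT hTF halg)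
        (not_finite_iff_infinite.2 ‹_›)
    · have : CharZero F := CharP.charP_to_charZero F
      have hfin := finiteDimensional_of_closure_eq_top hT hTF ⊥ halg.isAlgebraic
      have hQ : Function.Surjective (algebraMap ℚ (⊥ : Subfield F)) := by
        rintro ⟨z, hz⟩
        rw [Subfield.bot_eq_of_charZero] at hz
        obtain ⟨q, rfl⟩ := hz
        exact ⟨q, Subtype.ext (by simp)⟩
      have : Module.Finite ℚ (⊥ : Subfield F) :=
        Module.Finite.of_surjective (Algebra.linearMap ℚ (⊥ : Subfield F)) hQ
      have : FiniteDimensional ℚ F := Module.Finite.trans (⊥ : Subfield F) F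
      have : Algebra.IsAlgebraic ℤ F :=
        (IsFractionRing.comap_isAlgebraic_iff (A := ℤ) (K := ℚ) (C := F)).2 inferInstance
      exact exists_place_of_not_isIntegral (A := ℤ) ⊥
        (fun z hz => Valuation.exists_intCast_div_of_mem_bot hz)
        (fun d hd => exists_not_isIntegral_of_finiteDimensional_rat ha hd) S hS
  · obtain ⟨s, hs, ht⟩ := exists_transcendental_mul_sq halg ha
    obtain ⟨W, π, hπ, hW, x, hx⟩ := exists_place_of_transcendental hT hTF ht (insert s S)
      (by simp [hs.symm, hS])
    refine ⟨W, π, hπ, fun r hr => hW r (Finset.mem_insert_of_mem hr), x / s, ?_⟩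
    have : (x / s) ^ 2 - a = (x ^ 2 - a * s ^ 2) / s ^ 2 := by field_simp
    rw [this, map_div₀, map_pow, hW s (Finset.mem_insert_self _ _), one_pow, div_one]
    exact hx

/-! ### Square classes and rigid elements in a finitely generated field -/

lemma Subgroup.mem_square_units_iff {F : Type*} [Field F] (a : Fˣ) :
    a ∈ Subgroup.square Fˣ ↔ IsSquare (a : F) := by
  rw [Subgroup.mem_square]
  constructor
  · rintro ⟨b, rfl⟩
    exact ⟨b, by simp⟩
  · rintro ⟨b, hb⟩
    have hb0 : b ≠ 0 := by rintro rfl; exact a.ne_zero (by rw [hb, zero_mul])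
    exact ⟨Units.mk0 b hb0, Units.ext hb⟩

/-- The value of a uniformizer is not a square, even up to the square of a field element. -/
lemma ValuationSubring.IsUniformizer.ne_mul_self {F : Type*} [Field F] {W : ValuationSubring F}
    {π : F} (hπ : W.IsUniformizer π) (b : F) : W.valuation π ≠ W.valuation b * W.valuation b := by
  obtain ⟨h0, h1, hz⟩ := hπ
  have hp : W.valuation π ≠ 0 := by simpa using h0
  intro h
  have hb : b ≠ 0 := by rintro rfl; simp [h0] at h
  obtain ⟨n, hn⟩ := hz b hb
  rw [hn, ← zpow_add₀ hp] at h
  have hinj : Function.Injective fun m : ℤ => W.valuation π ^ m :=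
    zpow_right_injective₀ (zero_lt_iff.mpr hp) h1.ne
  have := @hinj 1 (n + n) (by simpa using h)
  omega

/-- Finitely many square classes would have representatives that are units at a common place,
and none of them would contain a uniformizer there. -/
lemma HasSplitPlaces.infinite_quotient_square {F : Type*} [Field F] (hF : HasSplitPlaces F) :
    Infinite (Fˣ ⧸ Subgroup.square Fˣ) := by
  classical
  by_contra hfin
  rw [not_infinite_iff_finite] at hfin
  have := Fintype.ofFinite (Fˣ ⧸ Subgroup.square Fˣ)
  obtain ⟨W, π, hπ, hS, -⟩ := hF 1 one_ne_zero
    (Finset.univ.image fun q : Fˣ ⧸ Subgroup.square Fˣ => (q.out : F)) (by simp)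
  have hq : W.valuation ((QuotientGroup.mk (s := Subgroup.square Fˣ)
      (Units.mk0 π hπ.1)).out : F) = 1 := hS _ (by simp)
  obtain ⟨⟨c, hc⟩, hc'⟩ := QuotientGroup.mk_out_eq_mul (Subgroup.square Fˣ) (Units.mk0 π hπ.1)
  rw [hc'] at hq
  rw [Subgroup.mem_square_units_iff] at hc
  obtain ⟨b, hb⟩ := hc
  simp only [Units.val_mul, Units.val_mk0, hb, map_mul] at hq
  have hb0 : b ≠ 0 := by rintro rfl; exact c.ne_zero (by rw [hb, zero_mul])
  apply hπ.ne_mul_self b⁻¹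
  rw [map_inv₀, ← mul_inv]
  exact eq_inv_of_mul_eq_one_left hq

/-- In characteristic two, if `a` were rigid, then `1 + a` would be of the form `s²` or `a s²`, and
either makes `a` a square; but then `a + a = 0` would lie in `F*² ∪ a F*²`. -/
lemma not_isRigidElement_square_of_charTwo {F : Type*} [Field F] [CharP F 2] (a : Fˣ) :
    ¬ IsRigidElement (Subgroup.square Fˣ) a := by
  intro h
  have hsq : IsSquare (a : F) := by
    obtain ⟨u, hu, h1⟩ := h 1 (one_mem _) 1 (one_mem _)
    rw [Subgroup.mem_square_units_iff] at hu
    obtain ⟨s, hs⟩ := hu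
    rw [hs, Units.val_one, one_mul] at h1
    rcases h1 with h1 | h1
    · refine ⟨s + 1, ?_⟩
      linear_combination h1 - (s + 1) * CharTwo.two_eq_zero (R := F)
    · have hne : s + 1 ≠ 0 := by
        intro h0
        have : (1 : F) = 0 := by linear_combination h1 + a * (s - 1) * h0
        exact one_ne_zero this
      refine ⟨(s + 1)⁻¹, ?_⟩
      field_simp
      linear_combination -h1 + (a * s + a) * CharTwo.two_eq_zero (R := F)
  obtain ⟨u, -, h1⟩ := h a ((Subgroup.mem_square_units_iff a).mpr hsq) 1 (one_mem _)
  have h0 : (a : F) + (1 : Fˣ) * a = 0 := by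
    rw [Units.val_one, one_mul, CharTwo.add_self_eq_zero]
  rw [h0] at h1
  rcases h1 with h1 | h1
  · exact u.ne_zero h1.symm
  · exact (u * a).ne_zero (by simpa using h1.symm)

/-- In characteristic other than two, at a place where `-a` is a square, some `x² + a`
has the value of a uniformizer, whereas the elements of `F*² ∪ a F*²` have even value. -/
lemma HasSplitPlaces.not_isRigidElement_square {F : Type*} [Field F] (hF : HasSplitPlaces F)
    (a : Fˣ) : ¬ IsRigidElement (Subgroup.square Fˣ) a := by
  by_cases h2 : (2 : F) = 0
  · have : CharP F 2 := CharTwo.of_one_ne_zero_of_two_eq_zero one_ne_zero h2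
    exact not_isRigidElement_square_of_charTwo a
  intro h
  classical
  obtain ⟨W, π, hπ, hS, x, hx⟩ := hF (-a) (neg_ne_zero.mpr a.ne_zero) {2, (a : F)}
    (by simp [Ne.symm h2, a.ne_zero.symm])
  have hw2 : W.valuation 2 = 1 := hS _ (by simp)
  have hwa : W.valuation a = 1 := hS _ (by simp)
  rw [sub_neg_eq_add] at hx
  have hp0 : W.valuation π ≠ 0 := by simpa using hπ.1
  -- a value below `1` is at most that of the uniformizer
  have hle : ∀ z : F, W.valuation z < 1 → W.valuation z ≤ W.valuation π := by
    intro z hz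
    rcases eq_or_ne z 0 with rfl | hz0
    · simp
    obtain ⟨n, hn⟩ := hπ.2.2 z hz0
    rw [hn] at hz ⊢
    have hn1 : 1 ≤ n := by
      by_contra hn'
      exact absurd hz (not_lt.mpr (one_le_zpow_of_nonpos₀ (zero_lt_iff.mpr hp0)
        hπ.2.1.le (by omega)))
    simpa using zpow_le_zpow_right_of_le_one₀ (zero_lt_iff.mpr hp0) hπ.2.1.le hn1
  have hxv : ∀ z : F, W.valuation (z ^ 2 + a) < 1 → W.valuation z = 1 := by
    intro z hz
    have : W.valuation (z ^ 2) = 1 := by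
      have h3 : z ^ 2 = (z ^ 2 + a) - a := by ring
      rw [h3, Valuation.map_sub_eq_of_lt_right _ (by rwa [hwa]), hwa]
    rw [map_pow] at this
    exact (pow_eq_one_iff_of_nonneg zero_le two_ne_zero).mp this
  obtain ⟨y, hy⟩ : ∃ y : F, W.valuation (y ^ 2 + a) = W.valuation π := by
    rcases (hle _ hx).eq_or_lt with h3 | h3
    · exact ⟨x, h3⟩
    · refine ⟨x + π, ?_⟩
      have h4 : (x + π) ^ 2 + a = (x ^ 2 + a) + π * (2 * x + π) := by ring
      have h5 : W.valuation (2 * x + π) = 1 := by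
        have h6 : W.valuation (2 * x) = 1 := by rw [map_mul, hw2, hxv x hx, one_mul]
        rw [Valuation.map_add_eq_of_lt_left _ (by rw [h6]; exact hπ.2.1), h6]
      have h7 : W.valuation (π * (2 * x + π)) = W.valuation π := by rw [map_mul, h5, mul_one]
      rw [h4, Valuation.map_add_eq_of_lt_right _ (by rwa [h7]), h7]
  have hy0 : y ≠ 0 := by
    rintro rfl
    have := hxv 0 (by rw [hy]; exact hπ.2.1)
    simp at this
  obtain ⟨u, hu, h1⟩ := h (Units.mk0 (y ^ 2) (pow_ne_zero _ hy0))
    ((Subgroup.mem_square_units_iff _).mpr ⟨y, by simp [sq]⟩) 1 (one_mem _)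
  rw [Subgroup.mem_square_units_iff] at hu
  obtain ⟨b, hb⟩ := hu
  rw [Units.val_mk0, Units.val_one, one_mul, hb] at h1
  apply hπ.ne_mul_self b
  rw [← hy]
  rcases h1 with h1 | h1 <;> simp [h1, hwa]

/-! ### The nominal transcendence degree -/

/-- In positive characteristic, a negative nominal transcendence degree means that the field is
algebraic over its prime field; being finitely generated, it is then finite. -/
lemma ntd_nonneg_iff_infinite {F : Type*} [Field F] {T : Set F} (hT : T.Finite)
    (hTF : Subfield.closure T = ⊤) : 0 ≤ ntd F ↔ Infinite F := by
  have hcases : (ringChar F = 0 ∨ ringChar F ≠ 0) := eq_or_ne _ _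
  unfold ntd etrdeg
  rw [← not_finite_iff_infinite]
  rcases hcases with h0 | h0
  · have : CharP F 0 := h0 ▸ ringChar.charP F
    have : CharZero F := CharP.charP_to_charZero F
    have hinf : ¬ Finite F := fun h => not_finite F
    simp only [h0, if_true, hinf, not_false_iff, iff_true]
    generalize Cardinal.toENat (Algebra.trdeg (⊥ : Subfield F) F) = d
    induction d using ENat.recTopCoe with
    | top => exact le_top
    | coe d => exact WithTop.coe_le_coe.2 (Int.natCast_nonneg d)
  · have hfin : Finite F ↔ Algebra.IsAlgebraic (⊥ : Subfield F) F := by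
      have := ringChar.charP F
      exact ⟨fun _ => inferInstance, finite_of_isAlgebraic_bot h0 hT hTF⟩
    rw [hfin, ← trdeg_eq_zero_iff]
    simp only [h0, if_false]
    have hd : Algebra.trdeg (⊥ : Subfield F) F = 0 ↔
        Cardinal.toENat (Algebra.trdeg (⊥ : Subfield F) F) = 0 := by simp
    rw [hd]
    generalize Cardinal.toENat (Algebra.trdeg (⊥ : Subfield F) F) = d
    induction d using ENat.recTopCoe with
    | top => exact iff_of_true le_top (by simp)
    | coe d =>
      change ((0 : ℤ) : WithTop ℤ) ≤ (((d : ℤ) - 1 : ℤ) : WithTop ℤ) ↔ _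
      rw [WithTop.coe_le_coe, Nat.cast_eq_zero]
      omega

/-! ### Square classes of a finite field -/

lemma index_square_of_ringChar_eq_two {F : Type*} [Field F] [Finite F] (h : ringChar F = 2) :
    (Subgroup.square Fˣ).index = 1 := by
  rw [Subgroup.index_eq_one, eq_top_iff]
  intro a _
  rw [Subgroup.mem_square_units_iff]
  exact FiniteField.isSquare_of_char_two h _

lemma index_square_of_ringChar_ne_two {F : Type*} [Field F] [Finite F] (h : ringChar F ≠ 2) :
    (Subgroup.square Fˣ).index = 2 := by
  have h1 : Subgroup.square Fˣ = (powMonoidHom 2 : Fˣ →* Fˣ).range := by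
    ext a
    simp [Subgroup.mem_square, IsSquare, MonoidHom.mem_range, sq, eq_comm]
  have := Fintype.ofFinite F
  rw [h1, IsCyclic.index_powMonoidHom_range]
  have h3 := FiniteField.odd_card_of_char_ne_two h
  have h4 : Nat.card Fˣ = Fintype.card F - 1 := by
    rw [Nat.card_units, Nat.card_eq_fintype_card]
  rw [h4, Nat.gcd_eq_right]
  omega

/-! ### The subgroups `(1 + M_v) K*²` and `U_v K*²` -/

lemma exists_rationalRank_eq_and_index_square {N : Type*} [CommGroup N] [IsMulTorsionFree N]
    [Group.FG N] : ∃ r : ℕ, rationalRank N = r ∧ (Subgroup.square N).index = 2 ^ r := by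
  have : Module.Finite ℤ (Additive N) :=
    Module.Finite.iff_addGroup_fg.2 inferInstance
  refine ⟨Module.finrank ℤ (Additive N), ?_, ?_⟩
  · rw [rationalRank, ← Module.finrank_eq_rank, Module.finrank_baseChange, map_natCast]
  · rw [← AddSubgroup.index_range_nsmul, ← Subgroup.index_toAddSubgroup]
    congr 1
    ext a
    rw [AddMonoidHom.mem_range]
    change IsSquare a.toMul ↔ _
    constructor
    · rintro ⟨b, hb⟩
      refine ⟨Additive.ofMul b, ?_⟩
      rw [nsmulAddMonoidHom_apply, two_nsmul]
      exact congrArg Additive.ofMul hb.symm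
    · rintro ⟨b, rfl⟩
      rw [nsmulAddMonoidHom_apply, two_nsmul]
      exact ⟨b.toMul, rfl⟩

namespace Valuation

variable {K Γ₀ : Type*} [Field K] [LinearOrderedCommGroupWithZero Γ₀] {v : Valuation K Γ₀}

lemma mem_principalUnitGroup_iff {x : Kˣ} :
    x ∈ v.valuationSubring.principalUnitGroup ↔ v (x - 1) < 1 := by
  rw [ValuationSubring.mem_principalUnitGroup_iff]
  exact v.isEquiv_valuation_valuationSubring.lt_one_iff_lt_one.symm

lemma principalUnitsMulSquares_le : v.principalUnitsMulSquares ≤ v.unitsMulSquares :=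
  sup_le_sup_right (ValuationSubring.principal_units_le_units _) _

lemma mem_principalUnitsMulSquares_of_map_sub_one_lt {x : Kˣ} (hx : v (x - 1) < 1) :
    x ∈ v.principalUnitsMulSquares :=
  Subgroup.mem_sup_left (mem_principalUnitGroup_iff.2 hx)

lemma mem_unitsMulSquares_of_map_eq_one {x : Kˣ} (hx : v x = 1) : x ∈ v.unitsMulSquares :=
  Subgroup.mem_sup_left ((mem_unitGroup_iff K v x).2 hx)

lemma neg_mem_unitsMulSquares {x : Kˣ} (hx : x ∈ v.unitsMulSquares) : -x ∈ v.unitsMulSquares := by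
  rw [← neg_one_mul]
  exact mul_mem (mem_unitsMulSquares_of_map_eq_one (by simp)) hx

lemma principalUnitsMulSquares_subgroupOf_unitGroup :
    v.principalUnitsMulSquares.subgroupOf v.valuationSubring.unitGroup =
      (Subgroup.square _).comap v.valuationSubring.unitGroupToResidueFieldUnits := by
  ext x
  rw [Subgroup.mem_subgroupOf, Subgroup.mem_comap, Subgroup.mem_square]
  constructor
  · intro h
    obtain ⟨p, hp, q, hq, hpq⟩ := Subgroup.mem_sup.1 h
    obtain ⟨b, rfl⟩ := Subgroup.mem_square.1 hq
    have hpU := ValuationSubring.principal_units_le_units _ hp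
    have hb : b ∈ v.valuationSubring.unitGroup := by
      have h1 : b * b ∈ v.valuationSubring.unitGroup := by
        rw [← inv_mul_cancel_left p (b * b), hpq]
        exact mul_mem (inv_mem hpU) x.2
      rw [mem_unitGroup_iff] at h1 ⊢
      rw [Units.val_mul, map_mul, ← sq] at h1
      exact (pow_eq_one_iff_of_nonneg zero_le two_ne_zero).mp h1
    have hx : x = ⟨p, hpU⟩ * (⟨b, hb⟩ * ⟨b, hb⟩) := Subtype.ext hpq.symm
    have hker : (⟨p, hpU⟩ : v.valuationSubring.unitGroup) ∈
        v.valuationSubring.unitGroupToResidueFieldUnits.ker := by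
      rw [ValuationSubring.ker_unitGroupToResidueFieldUnits]
      exact hp
    exact ⟨v.valuationSubring.unitGroupToResidueFieldUnits ⟨b, hb⟩, by
      rw [hx, _root_.map_mul, MonoidHom.mem_ker.1 hker, one_mul, _root_.map_mul]⟩
  · rintro ⟨r, hr⟩
    obtain ⟨y, rfl⟩ := v.valuationSubring.surjective_unitGroupToResidueFieldUnits r
    have hker : x * (y * y)⁻¹ ∈ v.valuationSubring.unitGroupToResidueFieldUnits.ker := by
      rw [MonoidHom.mem_ker, _root_.map_mul, hr, _root_.map_inv, _root_.map_mul, mul_inv_cancel]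
    rw [ValuationSubring.ker_unitGroupToResidueFieldUnits] at hker
    have := mul_mem (s := v.principalUnitsMulSquares) (Subgroup.mem_sup_left hker)
      (Subgroup.mem_sup_right (Subgroup.mem_square.2 (IsSquare.mul_self (y : Kˣ))))
    simpa [-mul_inv_rev] using this

/-- Whether a unit lies in `(1 + M_v) K*²` is decided in the residue field. -/
lemma mem_principalUnitsMulSquares_iff {x : v.valuationSubring.unitGroup} :
    (x : Kˣ) ∈ v.principalUnitsMulSquares ↔
      IsSquare (IsLocalRing.residue _
        (v.valuationSubring.unitGroupMulEquiv x : v.valuationSubring)) := by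
  change _ ↔ IsSquare ((v.valuationSubring.unitGroupToResidueFieldUnits x :
    (IsLocalRing.ResidueField v.valuationSubring)ˣ) : IsLocalRing.ResidueField v.valuationSubring)
  rw [← Subgroup.mem_square_units_iff, ← Subgroup.mem_comap,
    ← principalUnitsMulSquares_subgroupOf_unitGroup, Subgroup.mem_subgroupOf]

/-- The residue map induces an isomorphism between `U_v K*² / (1 + M_v) K*²` and the square classes
of the residue field. -/
lemma relIndex_principalUnitsMulSquares :
    v.principalUnitsMulSquares.relIndex v.unitsMulSquares =
      (Subgroup.square (IsLocalRing.ResidueField v.valuationSubring)ˣ).index := by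
  have h : v.unitsMulSquares = v.valuationSubring.unitGroup ⊔ v.principalUnitsMulSquares := by
    rw [unitsMulSquares, principalUnitsMulSquares, ← sup_assoc,
      sup_eq_left.2 (ValuationSubring.principal_units_le_units _)]
  rw [h, Subgroup.relIndex_sup_right, Subgroup.relIndex,
    principalUnitsMulSquares_subgroupOf_unitGroup, Subgroup.index_comap_of_surjective _
      (ValuationSubring.surjective_unitGroupToResidueFieldUnits _)]

lemma index_unitsMulSquares :
    v.unitsMulSquares.index = (Subgroup.square (v.valueSubgroup ⊤)).index := by
  let φ : Kˣ →* v.valueSubgroup ⊤ :=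
    (Units.map (v : K →* Γ₀)).codRestrict _ fun x => ⟨x, trivial, rfl⟩
  have hφ : Function.Surjective φ := by
    rintro ⟨γ, l, -, hl⟩
    exact ⟨Units.mk0 l (v.ne_zero_iff.1 (by simp [hl])), Subtype.ext (Units.ext hl)⟩
  have hker : φ.ker = v.valuationSubring.unitGroup := by
    ext x
    rw [MonoidHom.mem_ker, mem_unitGroup_iff]
    exact ⟨fun h => congrArg (fun γ : v.valueSubgroup ⊤ => ((γ : Γ₀ˣ) : Γ₀)) h,
      fun h => Subtype.ext (Units.ext h)⟩
  rw [← Subgroup.index_comap_of_surjective _ hφ]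
  congr 1
  refine le_antisymm (sup_le ?_ ?_) fun x hx => ?_
  · rw [← hker]
    exact MonoidHom.ker_le_comap _ _
  · rintro x hx
    exact Subgroup.mem_square.2 ((Subgroup.mem_square.1 hx).map φ)
  · obtain ⟨γ, hγ⟩ := Subgroup.mem_square.1 (Subgroup.mem_comap.1 hx)
    obtain ⟨b, rfl⟩ := hφ γ
    have h1 : x * (b * b)⁻¹ ∈ φ.ker := by
      rw [MonoidHom.mem_ker, _root_.map_mul, hγ, _root_.map_inv, _root_.map_mul, mul_inv_cancel]
    rw [hker] at h1
    have := mul_mem (s := v.unitsMulSquares) (Subgroup.mem_sup_left h1)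
      (Subgroup.mem_sup_right (Subgroup.mem_square.2 ⟨b, rfl⟩))
    simpa [-mul_inv_rev] using this

lemma HasFGInvariants.group_fg (h : v.HasFGInvariants ⊤) : Group.FG (v.valueSubgroup ⊤) := by
  obtain ⟨⟨S, hS, hle⟩, -⟩ := h
  have : Group.FG (Subgroup.closure S) :=
    (Group.fg_iff_subgroup_fg _).2 ((Subgroup.fg_iff _).2 ⟨S, rfl, hS⟩)
  have : Module.Finite ℤ (Additive (Subgroup.closure S)) :=
    Module.Finite.iff_addGroup_fg.2 inferInstance
  have : Module.Finite ℤ (Additive (v.valueSubgroup ⊤)) :=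
    Module.Finite.of_injective (MonoidHom.toAdditive (Subgroup.inclusion hle)).toIntLinearMap
      (Subgroup.inclusion_injective hle)
  exact AddGroup.fg_iff_mul_fg.1 (Module.Finite.iff_addGroup_fg.1 this)

lemma HasFGInvariants.closure_eq_top (h : v.HasFGInvariants ⊤) :
    ∃ T : Set (IsLocalRing.ResidueField v.valuationSubring),
      T.Finite ∧ Subfield.closure T = ⊤ := by
  obtain ⟨-, S, hS, hle⟩ := h
  refine ⟨S, hS, top_le_iff.1 fun z _ => hle ?_⟩
  obtain ⟨x, rfl⟩ := IsLocalRing.residue_surjective z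
  exact ⟨x, trivial, rfl⟩

end Valuation

/-! ### Rigid elements -/

section Rigid

variable {K : Type*} [Field K] {T : Subgroup Kˣ}

lemma IsRigidElement.of_mul_mem {x z : Kˣ} (hz : z ∈ T) (h : IsRigidElement T (x * z)) :
    IsRigidElement T x := by
  intro s hs t ht
  obtain ⟨u, hu, h1⟩ := h s hs (t * z⁻¹) (mul_mem ht (inv_mem hz))
  have h2 : ((t * z⁻¹ : Kˣ) : K) * (x * z : Kˣ) = t * x := by
    push_cast
    field_simp
  rw [h2] at h1
  rcases h1 with h1 | h1
  · exact ⟨u, hu, Or.inl h1⟩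
  · exact ⟨u * z, mul_mem hu hz, Or.inr (by rw [h1]; push_cast; ring)⟩

/-- If `-x` lies in `T`, then `T + T x` contains `0`. -/
lemma not_isRigidElement_of_neg_mem {x : Kˣ} (hx : -x ∈ T) : ¬ IsRigidElement T x := by
  intro h
  obtain ⟨u, -, h1⟩ := h (-x) hx 1 (one_mem _)
  simp only [Units.val_neg, Units.val_one, one_mul, neg_add_cancel] at h1
  rcases h1 with h1 | h1
  · exact u.ne_zero h1.symm
  · exact (u * x).ne_zero (by simpa using h1.symm)

lemma plusMinus_subset_basicPart : plusMinus T ⊆ basicPart T := by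
  rintro x (hx | hx)
  · exact Or.inr (not_isRigidElement_of_neg_mem (by rwa [neg_neg]))
  · exact Or.inl (not_isRigidElement_of_neg_mem hx)

lemma subset_basicPart : (T : Set Kˣ) ⊆ basicPart T :=
  fun _ hx => plusMinus_subset_basicPart (Or.inl hx)

end Rigid

namespace Valuation

variable {K Γ₀ : Type*} [Field K] [LinearOrderedCommGroupWithZero Γ₀] {v : Valuation K Γ₀}

/-- A sum of two terms of different value differs from the dominating one by a principal unit, so
only sums of terms of the same value matter for rigidity. -/
lemma isRigidElement_principalUnitsMulSquares {x : Kˣ}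
    (h : ∀ w : Kˣ, w * x⁻¹ ∈ v.principalUnitsMulSquares → v w = 1 →
      ∃ u ∈ v.principalUnitsMulSquares, (1 : K) + w = u ∨ (1 : K) + w = u * x) :
    IsRigidElement v.principalUnitsMulSquares x := by
  have key : ∀ w : Kˣ, v w < 1 → ∃ u ∈ v.principalUnitsMulSquares, (1 : K) + w = u := by
    intro w hw
    have h0 : (1 : K) + w ≠ 0 := by
      rw [← v.ne_zero_iff, v.map_one_add_of_lt hw]
      exact one_ne_zero
    exact ⟨Units.mk0 _ h0, mem_principalUnitsMulSquares_of_map_sub_one_lt (by simpa using hw), rfl⟩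
  intro s hs t ht
  set w := t * x * s⁻¹ with hw
  have hsw : (s : K) + t * x = s * (1 + w) := by
    rw [hw]; push_cast; field_simp
  have hwx : w * x⁻¹ ∈ v.principalUnitsMulSquares := by
    have : w * x⁻¹ = t * s⁻¹ := by rw [hw, mul_right_comm t x, mul_inv_cancel_right]
    rw [this]
    exact mul_mem ht (inv_mem hs)
  rcases lt_trichotomy (v w) 1 with h1 | h1 | h1
  · obtain ⟨u, hu, h2⟩ := key w h1
    exact ⟨s * u, mul_mem hs hu, Or.inl (by rw [hsw, h2]; push_cast; rfl)⟩
  · obtain ⟨u, hu, h2⟩ := h w hwx h1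
    refine ⟨s * u, mul_mem hs hu, h2.imp (fun h2 => ?_) fun h2 => ?_⟩
    · rw [hsw, h2]; push_cast; rfl
    · rw [hsw, h2]; push_cast; ring
  · obtain ⟨u, hu, h2⟩ := key w⁻¹ (by
      rw [Units.val_inv_eq_inv_val, map_inv₀]; exact inv_lt_one_of_one_lt₀ h1)
    refine ⟨t * u, mul_mem ht hu, Or.inr ?_⟩
    push_cast
    rw [← h2, hw]
    push_cast
    field_simp
    ring

lemma basicPart_subset_unitsMulSquares :
    basicPart v.principalUnitsMulSquares ⊆ v.unitsMulSquares := by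
  have key : ∀ x : Kˣ, x ∉ v.unitsMulSquares → IsRigidElement v.principalUnitsMulSquares x := by
    intro x hx
    refine isRigidElement_principalUnitsMulSquares fun w hw h1 => absurd ?_ hx
    have := mul_mem (inv_mem (principalUnitsMulSquares_le hw))
      (mem_unitsMulSquares_of_map_eq_one h1)
    simpa using this
  intro x hx
  by_contra hxU
  rcases hx with hx | hx
  · exact hx (key x hxU)
  · exact hx (key (-x) fun h => hxU (by simpa using neg_mem_unitsMulSquares h))

/-- If `-1` is in `T = (1 + M_v) K*²` and `T` has index two in `U_v K*²`, then for `x ∉ T` the sums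
`1 + w` with `w ∈ T x` a unit are units themselves, hence lie in `T ∪ T x`. -/
lemma isRigidElement_of_relIndex_eq_two
    (h2 : v.principalUnitsMulSquares.relIndex v.unitsMulSquares = 2)
    (hneg : -1 ∈ v.principalUnitsMulSquares) {x : Kˣ} (hx : x ∈ v.unitsMulSquares)
    (hxT : x ∉ v.principalUnitsMulSquares) : IsRigidElement v.principalUnitsMulSquares x := by
  refine isRigidElement_principalUnitsMulSquares fun w hw h1 => ?_
  have hwT : w ∉ v.principalUnitsMulSquares := fun h => hxT (by
    simpa using mul_mem (inv_mem hw) h)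
  have h1w : v (1 + w) = 1 := by
    refine le_antisymm ((v.map_add 1 (w : K)).trans (by simp [h1])) (not_lt.1 fun hlt => hwT ?_)
    have h3 : -w ∈ v.principalUnitsMulSquares := by
      refine mem_principalUnitsMulSquares_of_map_sub_one_lt ?_
      have h4 : ((-w : Kˣ) : K) - 1 = -(1 + w) := by push_cast; ring
      rwa [h4, Valuation.map_neg]
    simpa using mul_mem hneg h3
  have h0 : (1 : K) + w ≠ 0 := by
    rw [← v.ne_zero_iff, h1w]
    exact one_ne_zero
  have hyU : Units.mk0 _ h0 ∈ v.unitsMulSquares := mem_unitsMulSquares_of_map_eq_one h1w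
  by_cases hy : Units.mk0 _ h0 ∈ v.principalUnitsMulSquares
  · exact ⟨_, hy, Or.inl rfl⟩
  · refine ⟨Units.mk0 _ h0 * x⁻¹, ?_, Or.inr (by simp)⟩
    have := Subgroup.mul_mem_iff_of_index_two (H := v.principalUnitsMulSquares.subgroupOf _) h2
      (a := ⟨_, hyU⟩) (b := ⟨_, inv_mem hx⟩)
    simp only [Subgroup.mem_subgroupOf, Subgroup.coe_mul, inv_mem_iff] at this
    exact this.2 (iff_of_false hy hxT)

/-- Rigidity of a unit descends to the residue field. If a sum of a square and of a square multiple
of `x` reduced to `0`, then `-x` would lie in `(1 + M_v) K*²`, which rules out rigidity. -/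
lemma isRigidElement_residue {x : v.valuationSubring.unitGroup}
    (h : IsRigidElement v.principalUnitsMulSquares (x : Kˣ)) :
    IsRigidElement (Subgroup.square _) (v.valuationSubring.unitGroupToResidueFieldUnits x) := by
  set ρ := v.valuationSubring.unitGroupToResidueFieldUnits
  let ι : v.valuationSubring.unitGroup → v.valuationSubring :=
    fun y => v.valuationSubring.unitGroupMulEquiv y
  have hρ : ∀ y, (ρ y : IsLocalRing.ResidueField v.valuationSubring) =
      IsLocalRing.residue _ (ι y) := fun y => rfl
  intro s hs t ht
  obtain ⟨r, rfl⟩ := Subgroup.mem_square.1 hs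
  obtain ⟨r', rfl⟩ := Subgroup.mem_square.1 ht
  obtain ⟨a, rfl⟩ := v.valuationSubring.surjective_unitGroupToResidueFieldUnits r
  obtain ⟨b, rfl⟩ := v.valuationSubring.surjective_unitGroupToResidueFieldUnits r'
  have hsq : ∀ y : Kˣ, y * y ∈ v.principalUnitsMulSquares := fun y =>
    Subgroup.mem_sup_right (Subgroup.mem_square.2 ⟨y, rfl⟩)
  obtain ⟨c, hc, h1⟩ := h _ (hsq a) _ (hsq b)
  set e : v.valuationSubring := ι a * ι a + ι b * ι b * ι x with he
  have heK : (e : K) = ((a : Kˣ) * a : Kˣ) + ((b : Kˣ) * b : Kˣ) * ((x : Kˣ) : K) := rfl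
  have hres : ((ρ a * ρ a : (IsLocalRing.ResidueField v.valuationSubring)ˣ) :
      IsLocalRing.ResidueField v.valuationSubring) +
      (ρ b * ρ b : (IsLocalRing.ResidueField v.valuationSubring)ˣ) * ρ x =
      IsLocalRing.residue _ e := by
    rw [he]
    simp only [Units.val_mul, hρ, _root_.map_add, _root_.map_mul]
  have hunit : ∀ y : v.valuationSubring.unitGroup, v (y : Kˣ) = 1 := fun y =>
    (mem_unitGroup_iff K v _).1 y.2
  rw [← heK] at h1
  rw [hres]
  by_cases h0 : IsLocalRing.residue _ e = 0
  · refine absurd h (not_isRigidElement_of_neg_mem ?_)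
    have hy : -(x : Kˣ) ∈ v.valuationSubring.unitGroup :=
      (mem_unitGroup_iff K v _).2 (by simp [hunit x])
    refine (mem_principalUnitsMulSquares_iff (x := ⟨_, hy⟩)).2
      ⟨IsLocalRing.residue _ (ι a) / IsLocalRing.residue _ (ι b), ?_⟩
    have h2 : (v.valuationSubring.unitGroupMulEquiv ⟨_, hy⟩ : v.valuationSubring) = -ι x :=
      Subtype.ext rfl
    have hb : IsLocalRing.residue _ (ι b) ≠ 0 := by
      rw [← hρ]
      exact (ρ b).ne_zero
    rw [h2, _root_.map_neg]
    rw [he] at h0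
    simp only [_root_.map_add, _root_.map_mul] at h0
    field_simp
    linear_combination -h0
  · have hve : v e = 1 := (residue_ne_zero_iff_eq_one e).1 h0
    have hcU : c ∈ v.valuationSubring.unitGroup := by
      rw [mem_unitGroup_iff]
      rcases h1 with h1 | h1
      · rw [← h1, hve]
      · rwa [h1, Valuation.map_mul, hunit x, mul_one] at hve
    refine ⟨ρ ⟨c, hcU⟩, (Subgroup.mem_square_units_iff _).2
      ((mem_principalUnitsMulSquares_iff (x := ⟨c, hcU⟩)).1 hc), h1.imp (fun h1 => ?_) fun h1 => ?_⟩
    · rw [hρ]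
      exact congrArg _ (Subtype.ext h1)
    · have h2 : e = ι ⟨c, hcU⟩ * ι x := Subtype.ext h1
      rw [h2, _root_.map_mul, hρ, hρ]

lemma basicPart_eq_unitsMulSquares (h : ∀ a : (IsLocalRing.ResidueField v.valuationSubring)ˣ,
    ¬ IsRigidElement (Subgroup.square _) a) :
    basicPart v.principalUnitsMulSquares = v.unitsMulSquares := by
  refine basicPart_subset_unitsMulSquares.antisymm fun x hx => Or.inl fun hr => ?_
  obtain ⟨u, hu, q, hq, rfl⟩ := Subgroup.mem_sup.1 hx
  exact h _ (isRigidElement_residue (x := ⟨u, hu⟩)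
    (hr.of_mul_mem (Subgroup.mem_sup_right hq)))

end Valuation

theorem mainTheorem8 {k K Γ₀ : Type*} [Field k] [Field K] [Algebra k K]
    [LinearOrderedCommGroupWithZero Γ₀] (hk : IsGlobalField k) (hK : IsFunctionFieldOver k K)
    (v : Valuation K Γ₀) (hv : v.IsAbhyankar k) :
    let Kv := IsLocalRing.ResidueField v.valuationSubring
    let UK := v.unitsMulSquares
    let T := v.principalUnitsMulSquares
    -- exactly one of `ntd Kv ≥ 0` and `Kv` finite holds, so the cases below are exhaustive
    (0 ≤ ntd Kv ↔ Infinite Kv) ∧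
    -- the index of `U_v K*²` in `K*`
    (∃ r : ℕ, rationalRank (MonoidWithZeroHom.valueGroup (.ofClass v)) = r ∧ UK.index = 2 ^ r) ∧
    -- the index of `T` in `U_v K*²`
    T ≤ UK ∧
    (0 ≤ ntd Kv → Infinite (UK ⧸ T.subgroupOf UK)) ∧
    (Finite Kv → ringChar Kv ≠ 2 → T.relIndex UK = 2) ∧
    (Finite Kv → ringChar Kv = 2 → T.relIndex UK = 1) ∧
    -- the basic part of `T`
    (0 ≤ ntd Kv → basicPart T = UK) ∧
    (Finite Kv → ringChar Kv ≠ 2 → ¬ IsSquare (-1 : Kv) →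
      basicPart T = plusMinus T ∧ plusMinus T = UK) ∧
    (Finite Kv → ringChar Kv ≠ 2 → IsSquare (-1 : Kv) → basicPart T = T) ∧
    (Finite Kv → ringChar Kv = 2 → basicPart T = T ∧ T = UK) := by
  have hfg : v.HasFGInvariants ⊤ := hv.hasFGInvariants hK
    (Valuation.hasFGInvariants_of_isGlobalField hk (algebraMap k K))
  have := hfg.group_fg
  obtain ⟨S, hS, hSK⟩ := hfg.closure_eq_top
  intro Kv UK T
  have hntd : 0 ≤ ntd Kv ↔ Infinite Kv := ntd_nonneg_iff_infinite hS hSK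
  have hsplit : 0 ≤ ntd Kv → HasSplitPlaces Kv := fun h =>
    have := hntd.1 h
    hasSplitPlaces_of_fg hS hSK
  have hTU : T ≤ UK := Valuation.principalUnitsMulSquares_le
  have hodd : Finite Kv → ringChar Kv ≠ 2 → T.relIndex UK = 2 := fun _ h2 =>
    Valuation.relIndex_principalUnitsMulSquares.trans (index_square_of_ringChar_ne_two h2)
  have heven : Finite Kv → ringChar Kv = 2 → T.relIndex UK = 1 := fun _ h2 =>
    Valuation.relIndex_principalUnitsMulSquares.trans (index_square_of_ringChar_eq_two h2)
  -- `-1` is a unit, so its membership in `T` is decided in the residue field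
  have hneg : (-1 : Kˣ) ∈ T ↔ IsSquare (-1 : Kv) := by
    have hU : (-1 : Kˣ) ∈ v.valuationSubring.unitGroup :=
      (Valuation.mem_unitGroup_iff K v _).2 (by simp)
    have h1 : (v.valuationSubring.unitGroupMulEquiv ⟨_, hU⟩ : v.valuationSubring) = -1 :=
      Subtype.ext rfl
    rw [Valuation.mem_principalUnitsMulSquares_iff (x := ⟨_, hU⟩), h1, map_neg, map_one]
  have hBU : basicPart T ⊆ UK := Valuation.basicPart_subset_unitsMulSquares
  refine ⟨hntd, ?_, hTU, fun h => ?_, hodd, heven, fun h => ?_, fun hf h2 hsq => ?_,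
    fun hf h2 hsq => ?_, fun hf h2 => ?_⟩
  · rw [Valuation.valueGroup_eq_valueSubgroup, Valuation.index_unitsMulSquares]
    exact exists_rationalRank_eq_and_index_square
  · have := (hsplit h).infinite_quotient_square
    rw [← Subgroup.index_eq_zero_iff_infinite] at this ⊢
    exact Valuation.relIndex_principalUnitsMulSquares.trans this
  · exact Valuation.basicPart_eq_unitsMulSquares (hsplit h).not_isRigidElement_square
  · have hpm : plusMinus T = UK := by
      refine (plusMinus_subset_basicPart.trans hBU).antisymm fun x hx => ?_
      have hU1 : (-1 : Kˣ) ∈ UK := Valuation.neg_mem_unitsMulSquares (one_mem _)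
      have h3 := Subgroup.mul_mem_iff_of_index_two (H := T.subgroupOf UK) (hodd hf h2)
        (a := ⟨_, hU1⟩) (b := ⟨x, hx⟩)
      simp only [Subgroup.mem_subgroupOf, Subgroup.coe_mul, neg_one_mul] at h3
      by_cases hxT : x ∈ T
      · exact Or.inl hxT
      · exact Or.inr (h3.2 (iff_of_false (mt hneg.1 hsq) hxT))
    exact ⟨(hBU.trans hpm.ge).antisymm plusMinus_subset_basicPart, hpm⟩
  · refine Set.Subset.antisymm (fun x hx => ?_) subset_basicPart
    by_contra hxT
    have hxU := hBU hx
    have hnT : -x ∉ T := fun h => hxT (by simpa using mul_mem (hneg.2 hsq) h)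
    rcases hx with hx | hx
    · exact hx (Valuation.isRigidElement_of_relIndex_eq_two (hodd hf h2) (hneg.2 hsq) hxU hxT)
    · exact hx (Valuation.isRigidElement_of_relIndex_eq_two (hodd hf h2) (hneg.2 hsq)
        (Valuation.neg_mem_unitsMulSquares hxU) hnT)
  · have hT : T = UK := hTU.antisymm (Subgroup.relIndex_eq_one.1 (heven hf h2))
    exact ⟨(hBU.trans hT.ge).antisymm subset_basicPart, hT⟩
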